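/- **Proposition 3.1.** For a field $k$ of characteristic not $2$, let $\mathrm{Quat}(k)$ be the set of isomorphism classes of quaternion algebras with center $k$, and let $\mathrm{Quat}^*(k)\subset \mathrm{Quat}(k)$ be the subset of classes of division algebras. For a field extension $k'/k$ let $\mathscr{E}_{k'/k}:\mathrm{Quat}(k)\to\mathrm{Quat}(k')$ be the extension of scalars map $D\mapsto D\otimes_k k'$. Two division algebras over $k$ are *linked* if they share a common maximal subfield (up to $k$-isomorphism). For a quadratic form $\varphi=w_1x_1^2+\dots+w_rx_r^2$ over $k$ such that $k[x_1,\dots,x_r]/(\varphi)$ is a domain, put $k[\varphi]:=\mathrm{Frac}\bigl(k[x_1,\dots,x_r]/(\varphi)\bigr)$. Let $F$ be a field of characteristic not $2$, let $\mathcal{D}\subset \mathrm{Quat}^*(F)$ be a set whose elements are pairwise linked, and let $S\subset F^\times/(F^\times)^2$. Then there exists a field extension $F_S/F$ such that 1. the map $\mathscr{E}_{F_S/F}$ sends $\mathcal{D}$ into $\mathrm{Quat}^*(F_S)$, and its restriction $\mathcal{D}\to\mathrm{Quat}^*(F_S)$ is injective; 2. each algebra in the image $\mathscr{E}_{F_S/F}(\mathcal{D})$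 contains $F_S(\sqrt{c})$ for all $c\in S$ (where $F_S(\sqrt c)=F_S$ if $c$ is a square in $F_S$). Moreover, $F_S$ can be chosen to be a transfinite tower of function fields of quadrics over $F$: there are a well-ordered set $I$, intermediate fields $F\subset F_i\subset F_S$ $(i\in I)$, and diagonal quadratic forms $\varphi_i$ of dimension $4$ with coefficients in $F^\times$, such that $F_S$ is the union of $F$ and all the $F_i$, and for each $i\in I$, writing $M_i$ for the union of $F$ and all $F_j$ with $j<i$, one has $M_i\subset F_i$, the form $\varphi_i$ is not hyperbolic over $M_i$, and $F_i\cong M_i[\varphi_i]$ over $M_i$. -/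

import Mathlib

open scoped TensorProduct Quaternion

universe u

/-- A `k`-algebra is a quaternion algebra over `k` (characteristic not `2`) if it is isomorphic to
a Hilbert symbol algebra `(a, b / k)`, i.e. `k⟨i, j⟩` with `i² = a`, `j² = b`, `ij = -ji`, where
`a` and `b` are nonzero. -/
def IsQuaternionAlgebra (k A : Type*) [Field k] [Ring A] [Algebra k A] : Prop :=
  ∃ a b : kˣ, Nonempty (A ≃ₐ[k] ℍ[k, (a : k), (b : k)])

/-- The canonical map `ℍ[K, a, b] → K ⊗ ℍ[F, a, b]`. -/
noncomputable def quaternionBaseChangeHom (F K : Type*) [Field F] [Field K] [Algebra F K]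
    (a b : F) : ℍ[K, algebraMap F K a, algebraMap F K b] →ₐ[K] K ⊗[F] ℍ[F, a, b] :=
  QuaternionAlgebra.lift
    { i := 1 ⊗ₜ[F] (QuaternionAlgebra.Basis.self F).i
      j := 1 ⊗ₜ[F] (QuaternionAlgebra.Basis.self F).j
      k := 1 ⊗ₜ[F] (QuaternionAlgebra.Basis.self F).k
      i_mul_i := by
        rw [Algebra.TensorProduct.tmul_mul_tmul, QuaternionAlgebra.Basis.i_mul_i, zero_smul,
          zero_smul, add_zero, add_zero, one_mul, TensorProduct.tmul_smul, algebraMap_smul,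
          Algebra.TensorProduct.one_def]
      j_mul_j := by
        rw [Algebra.TensorProduct.tmul_mul_tmul, QuaternionAlgebra.Basis.j_mul_j, one_mul,
          TensorProduct.tmul_smul, algebraMap_smul, Algebra.TensorProduct.one_def]
      i_mul_j := by
        rw [Algebra.TensorProduct.tmul_mul_tmul, QuaternionAlgebra.Basis.i_mul_j, one_mul]
      j_mul_i := by
        rw [Algebra.TensorProduct.tmul_mul_tmul, QuaternionAlgebra.Basis.j_mul_i, one_mul,
          zero_smul, zero_smul, zero_sub, zero_sub, TensorProduct.tmul_neg] }

theorem quaternionBaseChangeHom_bijective (F K : Type*) [Field F] [Field K] [Algebra F K]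
    (a b : F) : Function.Bijective (quaternionBaseChangeHom F K a b) := by
  have hs : Function.Surjective (quaternionBaseChangeHom F K a b) := by
    intro z
    induction z using TensorProduct.induction_on with
    | zero => exact ⟨0, map_zero _⟩
    | add x y hx hy =>
      obtain ⟨x', rfl⟩ := hx
      obtain ⟨y', rfl⟩ := hy
      exact ⟨x' + y', map_add _ _ _⟩
    | tmul s q =>
      refine ⟨s • ⟨algebraMap F K q.re, algebraMap F K q.imI, algebraMap F K q.imJ,
        algebraMap F K q.imK⟩, ?_⟩
      have hq : q = q.re • (1 : ℍ[F, a, b]) + q.imI • (QuaternionAlgebra.Basis.self F).i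
          + q.imJ • (QuaternionAlgebra.Basis.self F).j
          + q.imK • (QuaternionAlgebra.Basis.self F).k := by
        ext <;> simp [QuaternionAlgebra.Basis.self]
      rw [map_smul]
      conv_rhs => rw [hq]
      simp only [quaternionBaseChangeHom, QuaternionAlgebra.lift_apply,
        QuaternionAlgebra.Basis.liftHom_apply, QuaternionAlgebra.Basis.lift,
        TensorProduct.tmul_add, TensorProduct.tmul_smul, smul_add,
        Algebra.TensorProduct.algebraMap_apply, TensorProduct.smul_tmul', smul_eq_mul,
        Algebra.smul_def (R := F) (A := K), Algebra.algebraMap_self, RingHom.id_apply, mul_one,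
        mul_comm s]
  have hd : Module.finrank K ℍ[K, algebraMap F K a, algebraMap F K b]
      = Module.finrank K (K ⊗[F] ℍ[F, a, b]) := by
    rw [Module.finrank_baseChange, QuaternionAlgebra.finrank_eq_four,
      QuaternionAlgebra.finrank_eq_four]
  have hi := (LinearMap.injective_iff_surjective_of_finrank_eq_finrank
    (f := (quaternionBaseChangeHom F K a b).toLinearMap) hd).2 hs
  exact ⟨hi, hs⟩

/-- Scalar extension of a quaternion algebra is a quaternion algebra. -/
theorem IsQuaternionAlgebra.baseChange {F A : Type*} (K : Type*) [Field F] [Field K] [Algebra F K]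
    [Ring A] [Algebra F A] (h : IsQuaternionAlgebra F A) : IsQuaternionAlgebra K (K ⊗[F] A) := by
  obtain ⟨a, b, ⟨e⟩⟩ := h
  refine ⟨Units.map (algebraMap F K) a, Units.map (algebraMap F K) b, ⟨?_⟩⟩
  exact (Algebra.TensorProduct.congr AlgEquiv.refl e).trans
    (AlgEquiv.ofBijective _ (quaternionBaseChangeHom_bijective F K a b)).symm

/-- A quaternion algebra over `k`, as a bundled object. -/
structure QuatAlg (k : Type u) [Field k] where
  carrier : Type u
  [ring : Ring carrier]
  [algebra : Algebra k carrier]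
  isQuaternion : IsQuaternionAlgebra k carrier

attribute [instance] QuatAlg.ring QuatAlg.algebra

/-- Isomorphism of quaternion algebras over `k`. -/
instance QuatAlg.setoid (k : Type u) [Field k] : Setoid (QuatAlg k) where
  r A B := Nonempty (A.carrier ≃ₐ[k] B.carrier)
  iseqv := ⟨fun _ => ⟨AlgEquiv.refl⟩, fun ⟨e⟩ => ⟨e.symm⟩, fun ⟨e⟩ ⟨f⟩ => ⟨e.trans f⟩⟩

/-- `Quat(k)`: the isomorphism classes of quaternion algebras over `k`. -/
def Quat (k : Type u) [Field k] : Type (u + 1) := Quotient (QuatAlg.setoid k)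

/-- `K ⊗ A` as a quaternion algebra over `K`. -/
noncomputable def QuatAlg.baseChange {F : Type u} [Field F] (K : Type u) [Field K] [Algebra F K]
    (A : QuatAlg F) : QuatAlg K where
  carrier := K ⊗[F] A.carrier
  isQuaternion := A.isQuaternion.baseChange K

/-- The extension of scalars map `Quat(F) → Quat(K)`, `D ↦ D ⊗ K`. -/
noncomputable def Quat.extend {F : Type u} [Field F] (K : Type u) [Field K] [Algebra F K] :
    Quat F → Quat K :=
  Quotient.map (QuatAlg.baseChange K)
    (fun _ _ ⟨e⟩ => ⟨Algebra.TensorProduct.congr AlgEquiv.refl e⟩)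

/-- `Quat*(k)`: the isomorphism classes of quaternion division algebras over `k`. -/
def QuatDiv (k : Type u) [Field k] : Set (Quat k) :=
  {D | ∃ A : QuatAlg k, D = Quotient.mk _ A ∧ ∀ x : A.carrier, x ≠ 0 → IsUnit x}

/-- `E` is a maximal subfield of the `k`-algebra `A`: it is maximal among the fields between
`k` and `A`. -/
def IsMaximalSubfield {k A : Type*} [Field k] [Ring A] [Algebra k A] (E : Subalgebra k A) : Prop :=
  Maximal (fun E' : Subalgebra k A => IsField E') E

/-- Two (isomorphism classes of) algebras are linked if they share a common maximal subfield, up to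
isomorphism over `k`. -/
def Quat.Linked {k : Type u} [Field k] (D D' : Quat k) : Prop :=
  ∃ A B : QuatAlg k, D = Quotient.mk _ A ∧ D' = Quotient.mk _ B ∧
    ∃ (E : Subalgebra k A.carrier) (E' : Subalgebra k B.carrier),
      IsMaximalSubfield E ∧ IsMaximalSubfield E' ∧ Nonempty (E ≃ₐ[k] E')

/-- The field `k(√c)`, equal to `k` when `c` is a square in `k`. -/
abbrev SqrtField (k : Type u) [Field k] (c : k) : Type u :=
  (Polynomial.X ^ 2 - Polynomial.C c : Polynomial k).SplittingField

/-- (An algebra in) the class `D` contains the extension field `E` of `k`. -/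
def Quat.Contains {k : Type u} [Field k] (D : Quat k) (E : Type u) [Field E] [Algebra k E] : Prop :=
  ∃ A : QuatAlg k, D = Quotient.mk _ A ∧ Nonempty (E →ₐ[k] A.carrier)

/-- The group of square classes `k^× / (k^×)²`. -/
abbrev SquareClass (k : Type u) [Field k] : Type u :=
  kˣ ⧸ (powMonoidHom 2 : kˣ →* kˣ).range

/-- A quadratic form is hyperbolic if it is isometric to an orthogonal sum of hyperbolic planes
`⟨1, -1⟩` (characteristic not `2`). -/
def IsHyperbolicForm {k V : Type*} [Field k] [AddCommGroup V] [Module k V]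
    (Q : QuadraticForm k V) : Prop :=
  ∃ m : ℕ, Q.Equivalent (QuadraticMap.weightedSumSquares k
    (Sum.elim (fun _ : Fin m => (1 : k)) (fun _ : Fin m => (-1 : k))))

/-- The big function field `k[φ] = Frac (k[x₁, …, xᵣ] / (φ))` of the diagonal quadratic form
`φ = w₁ x₁² + ⋯ + wᵣ xᵣ²`. -/
abbrev BigFunctionField (k : Type*) [Field k] {r : ℕ} (w : Fin r → k) : Type _ :=
  FractionRing (MvPolynomial (Fin r) k ⧸
    Ideal.span {∑ i, MvPolynomial.C (w i) * MvPolynomial.X i ^ 2})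

/-- `K / F` is a transfinite tower of function fields of quadrics: there are a well-ordered set `I`,
intermediate fields `L i` with union `K`, and regular four-dimensional quadratic forms `φ i` over
`F`, such that `φ i` is not hyperbolic over `M = ⋃ j < i, L j` and `L i = M[φ i]` for every `i`.
(Each supremum below is that of a chain, hence the union of its members, and is `F` when there are
none.) -/
def IsQuadricTower (F K : Type u) [Field F] [Field K] [Algebra F K] : Prop :=
  ∃ (I : Type u) (_ : LinearOrder I) (_ : WellFoundedLT I)
    (L : I → IntermediateField F K) (w : I → Fin 4 → Fˣ),
    (⨆ i, L i) = ⊤ ∧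
    ∀ i, ∃ (M : IntermediateField F K) (hM : M ≤ L i),
      M = (⨆ j : Set.Iio i, L j) ∧
      ¬ IsHyperbolicForm
        (QuadraticMap.weightedSumSquares M (fun n => algebraMap F M (w i n : F))) ∧
      Nonempty (BigFunctionField M (fun n => algebraMap F M (w i n : F)) ≃ₐ[M]
        IntermediateField.extendScalars hM)

/-! For a quaternion division algebra `(a, b)` and a nonsquare `c`, consider the quadric `-c X₀² + a
X₁² + b X₂² - ab X₃² = 0`. A point with `X₀ ≠ 0` gives a pure quaternion of square `c`, so `(a, b)`
contains `√c` over the function field of the quadric. The coefficients multiply to `c (ab)²`, so the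
discriminant is nontrivial. The tower adjoins a generic point of this quadric for every triple `(a,
b, c)` of units of `F` with `c` a nonsquare (`exists_quadricTower`).

The main point is that no division algebra is lost. Over the function field of a quadric of
nontrivial discriminant, anisotropic quaternion norm forms stay anisotropic
(`DiagAnisotropic.adjoin_quaternionNorm`): a new zero would make the pure part of the norm form
represent a generic value of a ternary form. By Cassels–Pfister the two ternary forms would then
have the same discriminant, which makes the discriminant of the quadric a square. Nonsquares of `F`
also stay nonsquares (`DiagAnisotropic.adjoin_binary`), so each quadric keeps a nontrivial
discriminant, and hence is not hyperbolic, at its own stage. Transfinite induction carries both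
facts up the tower.

Injectivity comes from linkage. Linked algebras have the form `(c, d₁)` and `(c, d₂)`, and they are
isomorphic exactly when `(c, d₁ d₂)` is split. If they are not isomorphic over `F`, then `(c, d₁
d₂)` is division over `F`, hence over the tower, so they remain nonisomorphic there. -/

/-- The diagonal quadratic form with coefficients `b` has no nontrivial zero. -/
def DiagAnisotropic {ι L : Type*} [Fintype ι] [CommRing L] (b : ι → L) : Prop :=
  ∀ v : ι → L, ∑ i, b i * v i ^ 2 = 0 → ∀ i, v i = 0

/-- The diagonal quadratic form with coefficients `b` takes the value `f`. -/
def DiagRepresents {ι L : Type*} [Fintype ι] [CommRing L] (b : ι → L) (f : L) : Prop :=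
  ∃ v : ι → L, ∑ i, b i * v i ^ 2 = f

/-! ### The Cassels–Pfister theorem and its consequences for diagonal forms. -/

section CasselsPfister

open Polynomial

variable {ι k : Type*} [Fintype ι] [Field k] {b : ι → k}

theorem coeff_sum_C_mul_sq (b : ι → k) (u : ι → k[X]) (n : ℕ) (hu : ∀ i, (u i).natDegree ≤ n) :
    (∑ i, C (b i) * u i ^ 2).coeff (2 * n) = ∑ i, b i * ((u i).coeff n) ^ 2 := by
  simp only [finsetSum_coeff, coeff_C_mul]
  refine Finset.sum_congr rfl fun i _ => ?_
  rw [coeff_pow_of_natDegree_le (hu i)]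

/-- The coefficients in the largest occurring degree form a nonzero vector, so by anisotropy the
leading terms cannot cancel. -/
theorem DiagAnisotropic.natDegree_le (hb : DiagAnisotropic b) (u : ι → k[X]) (m : ℕ)
    (h : (∑ i, C (b i) * u i ^ 2).natDegree ≤ 2 * m) (i : ι) : (u i).natDegree ≤ m := by
  by_contra hi
  obtain ⟨j, -, hj⟩ := Finset.exists_max_image Finset.univ (fun i => (u i).natDegree)
    ⟨i, Finset.mem_univ i⟩
  have hmj : m < (u j).natDegree := lt_of_lt_of_le (not_le.1 hi) (hj i (Finset.mem_univ i))
  have h0 := coeff_sum_C_mul_sq b u (u j).natDegree fun i => hj i (Finset.mem_univ i)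
  rw [coeff_eq_zero_of_natDegree_lt (lt_of_le_of_lt h (by omega))] at h0
  have h1 := hb _ h0.symm j
  rw [coeff_natDegree, leadingCoeff_eq_zero] at h1
  rw [h1, natDegree_zero] at hmj
  omega

theorem DiagAnisotropic.polynomial (hb : DiagAnisotropic b) :
    DiagAnisotropic fun i => (C (b i) : k[X]) := by
  intro u hu i
  have h0 : ∀ i, (u i).natDegree ≤ 0 := hb.natDegree_le u 0 (by rw [hu]; simp)
  have h1 := coeff_sum_C_mul_sq b u 0 h0
  rw [hu, coeff_zero] at h1
  rw [eq_C_of_natDegree_le_zero (h0 i), hb _ h1.symm i, C_0]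

/-- The Cassels–Pfister theorem: a polynomial represented over `k(t)` by an anisotropic diagonal
form over `k` is represented over `k[t]`. -/
theorem DiagAnisotropic.cassels_pfister (hb : DiagAnisotropic b) (f : k[X]) :
    ∀ (s : k[X]) (u : ι → k[X]), s ≠ 0 → ∑ i, C (b i) * u i ^ 2 = f * s ^ 2 →
      DiagRepresents (fun i => C (b i)) f := by
  intro s
  induction hn : s.natDegree using Nat.strong_induction_on generalizing s with
  | _ n ih =>
  intro u hs hu
  set g : ι → k[X] := fun i => u i / s with hg
  set r : ι → k[X] := fun i => u i % s with hr
  have hur : ∀ i, u i = s * g i + r i := fun i => (EuclideanDomain.div_add_mod (u i) s).symm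
  set G := ∑ i, C (b i) * g i ^ 2 with hG
  set H := ∑ i, C (b i) * (u i * g i) with hH
  have expand : ∀ p q : k[X], ∑ i, C (b i) * (p * u i - q * g i) ^ 2
      = p ^ 2 * (f * s ^ 2) - 2 * p * q * H + q ^ 2 * G := by
    intro p q
    rw [← hu, hH, hG, Finset.mul_sum, Finset.mul_sum, Finset.mul_sum, ← Finset.sum_sub_distrib,
      ← Finset.sum_add_distrib]
    exact Finset.sum_congr rfl fun i _ => by ring
  have hR : ∑ i, C (b i) * r i ^ 2 = f * s ^ 2 - 2 * s * H + s ^ 2 * G := by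
    have := expand 1 s
    simp only [one_pow, one_mul, mul_one] at this
    rw [← this]
    exact Finset.sum_congr rfl fun i _ => by rw [hur i]; ring
  by_cases hr0 : ∀ i, r i = 0
  · refine ⟨g, ?_⟩
    have h1 : ∑ i, C (b i) * u i ^ 2 = s ^ 2 * G := by
      rw [hG, Finset.mul_sum]
      exact Finset.sum_congr rfl fun i _ => by rw [hur i, hr0 i]; ring
    rw [hu, mul_comm] at h1
    exact (mul_left_cancel₀ (pow_ne_zero 2 hs) h1).symm
  -- The line through `u / s` and the nearby polynomial point `g` meets the quadric of value `f`
  -- again at `(a u - c g) / (a s - c)`. Since `s (a s - c)` is the value of the form at the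
  -- remainders, the new denominator has smaller degree.
  · set a := G - f
    set c := 2 * (H - f * s)
    have hsv : s * (a * s - c) = ∑ i, C (b i) * r i ^ 2 := by rw [hR]; ring
    have hv0 : a * s - c ≠ 0 := by
      intro h0
      rw [h0, mul_zero] at hsv
      exact hr0 (hb.polynomial r hsv.symm)
    have hsdeg : 0 < s.natDegree := by
      by_contra h0
      apply hr0
      intro i
      have hC := eq_C_of_natDegree_eq_zero (Nat.eq_zero_of_not_pos h0)
      have hsu : IsUnit s := by
        rw [hC, isUnit_C]
        refine isUnit_iff_ne_zero.2 fun h => hs ?_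
        rw [hC, h, C_0]
      exact (EuclideanDomain.mod_eq_zero).2 hsu.dvd
    have hrdeg : ∀ i, (r i).natDegree ≤ s.natDegree - 1 := fun i =>
      Nat.le_sub_one_of_lt (natDegree_mod_lt _ hsdeg.ne')
    have hdeg : (s * (a * s - c)).natDegree ≤ 2 * (s.natDegree - 1) := by
      rw [hsv]
      refine natDegree_sum_le_of_forall_le _ _ fun i _ => ?_
      refine (natDegree_C_mul_le _ _).trans (natDegree_pow_le.trans ?_)
      exact Nat.mul_le_mul_left 2 (hrdeg i)
    rw [natDegree_mul hs hv0] at hdeg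
    refine ih (a * s - c).natDegree (by omega) (a * s - c) rfl (fun i => a * u i - c * g i) hv0 ?_
    rw [expand a c]
    ring

theorem DiagAnisotropic.represents_of_ratFunc (hb : DiagAnisotropic b) {f : k[X]}
    (h : DiagRepresents (fun i => RatFunc.C (b i)) (algebraMap k[X] (RatFunc k) f)) :
    DiagRepresents (fun i => C (b i)) f := by
  obtain ⟨v, hv⟩ := h
  obtain ⟨s, hs⟩ := IsLocalization.exist_integer_multiples_of_finite (nonZeroDivisors k[X]) v
  choose u hu using hs
  refine hb.cassels_pfister f s u (nonZeroDivisors.coe_ne_zero s) ?_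
  apply IsFractionRing.injective k[X] (RatFunc k)
  rw [map_sum, map_mul, ← hv, Finset.sum_mul]
  refine Finset.sum_congr rfl fun i _ => ?_
  rw [map_mul, map_pow, hu i, map_pow, Algebra.smul_def, RatFunc.algebraMap_C]
  ring

theorem DiagAnisotropic.ratFunc (hb : DiagAnisotropic b) :
    DiagAnisotropic fun i => RatFunc.C (b i) := by
  intro v hv i
  obtain ⟨s, hs⟩ := IsLocalization.exist_integer_multiples_of_finite (nonZeroDivisors k[X]) v
  choose u hu using hs
  have h0 : ∑ i, C (b i) * u i ^ 2 = 0 := by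
    apply IsFractionRing.injective k[X] (RatFunc k)
    rw [map_sum, map_zero, ← mul_zero (algebraMap k[X] (RatFunc k) s ^ 2), ← hv, Finset.mul_sum]
    refine Finset.sum_congr rfl fun i _ => ?_
    rw [map_mul, map_pow, hu i, Algebra.smul_def, RatFunc.algebraMap_C]
    ring
  have h1 := hu i
  rw [hb.polynomial u h0 i, map_zero, Algebra.smul_def, eq_comm, mul_eq_zero] at h1
  refine h1.resolve_left fun h => nonZeroDivisors.coe_ne_zero s ?_
  exact IsFractionRing.injective k[X] (RatFunc k) (by rw [h, map_zero])

/-- Represented quadratic polynomials are represented by linear polynomials. -/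
theorem DiagAnisotropic.exists_linear (hb : DiagAnisotropic b) {f : k[X]} (hf : f.natDegree ≤ 2)
    (h : DiagRepresents (fun i => RatFunc.C (b i)) (algebraMap k[X] (RatFunc k) f)) :
    ∃ g : ι → k[X], (∀ i, (g i).natDegree ≤ 1) ∧ ∑ i, C (b i) * g i ^ 2 = f := by
  obtain ⟨g, hg⟩ := hb.represents_of_ratFunc h
  exact ⟨g, hb.natDegree_le g 1 (by rw [hg]; exact hf), hg⟩

theorem DiagAnisotropic.represents_const (hb : DiagAnisotropic b) {e : k}
    (h : DiagRepresents (fun i => RatFunc.C (b i)) (RatFunc.C e)) :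
    DiagRepresents b e := by
  obtain ⟨g, hg⟩ := hb.represents_of_ratFunc (f := C e) (by rwa [RatFunc.algebraMap_C])
  refine ⟨fun i => (g i).eval 0, ?_⟩
  simpa [eval_finsetSum] using congrArg (eval 0) hg

theorem natDegree_C_mul_X_sq_add_C_le (e c : k) : (C e * X ^ 2 + C c : k[X]).natDegree ≤ 2 := by
  compute_degree

/-- In a representation by linear polynomials, the coefficients of `t` form a vector at which `b`
takes the value `e`. -/
theorem DiagAnisotropic.represents_leadingCoeff (hb : DiagAnisotropic b) {e c : k}
    (h : DiagRepresents (fun i => RatFunc.C (b i))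
      (RatFunc.C e * RatFunc.X ^ 2 + RatFunc.C c)) :
    DiagRepresents b e := by
  obtain ⟨g, hd, hg⟩ := hb.exists_linear (natDegree_C_mul_X_sq_add_C_le e c)
    (by simpa only [map_add, map_mul, map_pow, RatFunc.algebraMap_C, RatFunc.algebraMap_X] using h)
  refine ⟨fun i => (g i).coeff 1, ?_⟩
  rw [← coeff_sum_C_mul_sq b g 1 hd, hg]
  simp

/-- If `b` represents `b₀ t² + c` over `k(t)` then the rest of the form represents `c`. -/
theorem DiagAnisotropic.represents_tail {n : ℕ} {b : Fin (n + 1) → k} {c : k} (h2 : (2 : k) ≠ 0)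
    (hb : DiagAnisotropic b)
    (h : DiagRepresents (fun i => RatFunc.C (b i))
      (RatFunc.C (b 0) * RatFunc.X ^ 2 + RatFunc.C c)) :
    DiagRepresents (fun i : Fin n => b i.succ) c := by
  obtain ⟨g, hd, hg⟩ := hb.exists_linear (natDegree_C_mul_X_sq_add_C_le (b 0) c)
    (by simpa only [map_add, map_mul, map_pow, RatFunc.algebraMap_C, RatFunc.algebraMap_X] using h)
  rw [Fin.sum_univ_succ] at hg
  -- Specialise `t` so that `g₀(t) = ± t`; the first terms then cancel. The equation `g₀(t) = t` has
  -- a solution unless `g₀` has slope one, and in that case `g₀(t) = -t` is solvable because `2 ≠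
  -- 0`.
  obtain ⟨t, ht⟩ : ∃ t : k, (g 0).eval t ^ 2 = t ^ 2 := by
    have hl : ∀ t, (g 0).eval t = (g 0).coeff 1 * t + (g 0).coeff 0 := by
      intro t
      conv_lhs => rw [eq_X_add_C_of_natDegree_le_one (hd 0)]
      simp
    by_cases h1 : (g 0).coeff 1 = 1
    · refine ⟨-(g 0).coeff 0 / 2, ?_⟩
      rw [hl, h1]
      field_simp
      ring
    · refine ⟨(g 0).coeff 0 / (1 - (g 0).coeff 1), ?_⟩
      have : 1 - (g 0).coeff 1 ≠ 0 := sub_ne_zero.2 (Ne.symm h1)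
      rw [hl]
      field_simp
      ring
  refine ⟨fun i => (g i.succ).eval t, ?_⟩
  have := congrArg (eval t) hg
  simp only [eval_add, eval_mul, eval_C, eval_pow, eval_X, eval_finsetSum, ht] at this
  exact add_left_cancel this

end CasselsPfister

/-! ### Splitting a represented value off a form of dimension at most three. -/

section Diagonalization

variable {k : Type u} [Field k]

/-- `b'` is a diagonal form which represents at least the values of `b`, over all extensions. -/
def DiagDominates {ι ι' : Type*} [Fintype ι] [Fintype ι'] (b : ι → k) (b' : ι' → k) : Prop :=
  ∀ (R : Type u) [Field R] (φ : k →+* R) (f : R), DiagRepresents (fun i => φ (b i)) f →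
    DiagRepresents (fun i => φ (b' i)) f

theorem DiagAnisotropic.ne_zero {ι : Type*} [Fintype ι] [DecidableEq ι] {b : ι → k}
    (hb : DiagAnisotropic b) (i : ι) : b i ≠ 0 := by
  intro h
  have := hb (Pi.single i 1) (by
    refine Finset.sum_eq_zero fun j _ => ?_
    by_cases hj : j = i
    · rw [hj, h, zero_mul]
    · rw [Pi.single_eq_of_ne hj]; simp) i
  simp at this

theorem unary_split {c e : k} (he : DiagRepresents ![c] e) (he0 : e ≠ 0) :
    DiagDominates ![c] ![e] := by
  obtain ⟨v, rfl⟩ := he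
  simp only [Fin.sum_univ_one, Matrix.cons_val_fin_one] at he0 ⊢
  intro R _ φ f ⟨w, hw⟩
  have hv : φ (v 0) ≠ 0 := by
    rw [ne_eq, map_eq_zero]
    rintro h
    rw [h] at he0
    simp at he0
  refine ⟨fun i => w i / φ (v 0), ?_⟩
  simp only [Fin.sum_univ_one, Matrix.cons_val_fin_one, map_mul, map_pow] at hw ⊢
  rw [← hw]
  field_simp

/-- If `v` is a vector of value `e`, the orthogonal vector `(-b v₁, a v₀)` has value `abe`; the new
coordinates are those in this orthogonal basis. -/
theorem binary_split {a b e : k} (hab : DiagAnisotropic ![a, b])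
    (he : DiagRepresents ![a, b] e) (he0 : e ≠ 0) :
    DiagAnisotropic ![e, a * b * e] ∧ DiagDominates ![a, b] ![e, a * b * e] := by
  obtain ⟨v, hv⟩ := he
  have ha := hab.ne_zero 0
  have hb := hab.ne_zero 1
  simp only [Fin.sum_univ_two, Matrix.cons_val_zero, Matrix.cons_val_one] at hv ha hb
  constructor
  · intro u hu
    simp only [Fin.sum_univ_two, Matrix.cons_val_zero, Matrix.cons_val_one] at hu
    have h1 : u 0 ^ 2 + a * b * u 1 ^ 2 = 0 := by
      apply mul_left_cancel₀ he0
      linear_combination hu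
    have h2 := hab ![u 0, a * u 1] (by
      simp only [Fin.sum_univ_two, Matrix.cons_val_zero, Matrix.cons_val_one]
      linear_combination a * h1)
    have h3 := h2 0
    have h4 := h2 1
    simp only [Matrix.cons_val_zero, Matrix.cons_val_one, mul_eq_zero, ha, false_or] at h3 h4
    intro i
    fin_cases i
    · exact h3
    · exact h4
  · intro R _ φ f ⟨w, hw⟩
    simp only [Fin.sum_univ_two, Matrix.cons_val_zero, Matrix.cons_val_one] at hw
    have he' : φ e ≠ 0 := (map_ne_zero φ).2 he0
    have hv' := congrArg φ hv
    simp only [map_add, map_mul, map_pow] at hv'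
    refine ⟨![(φ a * φ (v 0) * w 0 + φ b * φ (v 1) * w 1) / φ e,
      (φ (v 0) * w 1 - φ (v 1) * w 0) / φ e], ?_⟩
    simp only [Fin.sum_univ_two, Matrix.cons_val_zero, Matrix.cons_val_one, map_mul]
    field_simp
    rw [← hw, ← hv']
    ring

/-- Applies the binary change of basis twice: `⟨a, b⟩ ≅ ⟨m, abm⟩`, then `⟨m, c⟩ ≅ ⟨e, mce⟩`. When `m
= 0` the value `e` is `c` times a square, and permuting the coefficients suffices. The first
conjunct records that the discriminant is kept up to squares. -/
theorem ternary_split {a b c e : k} (habc : DiagAnisotropic ![a, b, c])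
    (he : DiagRepresents ![a, b, c] e) (he0 : e ≠ 0) :
    ∃ b' c' t : k, e * b' * c' * (a * b * c) = t ^ 2 ∧
      DiagAnisotropic ![e, b', c'] ∧ DiagDominates ![a, b, c] ![e, b', c'] := by
  obtain ⟨v, hv⟩ := he
  have ha := habc.ne_zero 0
  have hb := habc.ne_zero 1
  have hc := habc.ne_zero 2
  simp only [Fin.sum_univ_three, Matrix.cons_val_zero, Matrix.cons_val_one,
    Matrix.cons_val] at hv ha hb hc
  obtain ⟨m, hm⟩ : ∃ m, m = a * v 0 ^ 2 + b * v 1 ^ 2 := ⟨_, rfl⟩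
  have hem : e = m + c * v 2 ^ 2 := by rw [hm, ← hv]
  by_cases hm0 : m = 0
  · rw [hm0, zero_add] at hem
    have hr : v 2 ≠ 0 := by
      rintro h
      rw [h] at hem
      apply he0
      rw [hem]
      ring
    refine ⟨a, b, a * b * c * v 2, by rw [hem]; ring, ?_, ?_⟩
    · intro u hu
      simp only [Fin.sum_univ_three, Matrix.cons_val_zero, Matrix.cons_val_one,
        Matrix.cons_val] at hu
      have h := habc ![u 1, u 2, v 2 * u 0] (by
        simp only [Fin.sum_univ_three, Matrix.cons_val_zero, Matrix.cons_val_one,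
          Matrix.cons_val]
        rw [hem] at hu
        linear_combination hu)
      have h0 := h 0
      have h1 := h 1
      have h2 := h 2
      simp only [Matrix.cons_val_zero, Matrix.cons_val_one, Matrix.cons_val,
        mul_eq_zero, hr, false_or] at h0 h1 h2
      intro i
      fin_cases i
      · exact h2
      · exact h0
      · exact h1
    · intro R _ φ f ⟨w, hw⟩
      simp only [Fin.sum_univ_three, Matrix.cons_val_zero, Matrix.cons_val_one,
        Matrix.cons_val] at hw
      have hr' : φ (v 2) ≠ 0 := (map_ne_zero φ).2 hr
      refine ⟨![w 2 / φ (v 2), w 0, w 1], ?_⟩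
      simp only [Fin.sum_univ_three, Matrix.cons_val_zero, Matrix.cons_val_one,
        Matrix.cons_val, hem, map_mul, map_pow]
      field_simp
      rw [← hw]
      ring
  · refine ⟨m * c * e, a * b * m, a * b * c * m * e, by ring, ?_, ?_⟩
    · intro u hu
      simp only [Fin.sum_univ_three, Matrix.cons_val_zero, Matrix.cons_val_one,
        Matrix.cons_val] at hu
      have h := habc ![v 0 * (u 0 - c * v 2 * u 1) - b * v 1 * u 2,
          v 1 * (u 0 - c * v 2 * u 1) + a * v 0 * u 2, v 2 * u 0 + m * u 1] (by
        simp only [Fin.sum_univ_three, Matrix.cons_val_zero, Matrix.cons_val_one,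
          Matrix.cons_val]
        rw [← hu, hem, hm]
        ring)
      have h0 := h 0
      have h1 := h 1
      have h2 := h 2
      simp only [Matrix.cons_val_zero, Matrix.cons_val_one, Matrix.cons_val] at h0 h1 h2
      have hX : u 0 - c * v 2 * u 1 = 0 := by
        apply mul_left_cancel₀ hm0
        rw [hm]
        linear_combination a * v 0 * h0 + b * v 1 * h1
      have hz : u 2 = 0 := by
        apply mul_left_cancel₀ (mul_ne_zero (mul_ne_zero ha hb) hm0)
        rw [hm]
        linear_combination a * b * v 0 * h1 - a * b * v 1 * h0
      have hy : u 1 = 0 := by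
        apply mul_left_cancel₀ he0
        rw [hem]
        linear_combination h2 - v 2 * hX
      have hx : u 0 = 0 := by
        rw [hy] at hX
        linear_combination hX
      intro i
      fin_cases i
      · exact hx
      · exact hy
      · exact hz
    · intro R _ φ f ⟨w, hw⟩
      simp only [Fin.sum_univ_three, Matrix.cons_val_zero, Matrix.cons_val_one,
        Matrix.cons_val] at hw
      have hm' : φ m ≠ 0 := (map_ne_zero φ).2 hm0
      have he' : φ e ≠ 0 := (map_ne_zero φ).2 he0
      have hm2 := congrArg φ hm
      have he2 := congrArg φ hem
      simp only [map_add, map_mul, map_pow] at hm2 he2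
      obtain ⟨x, hx⟩ : ∃ x, φ m * x = φ a * φ (v 0) * w 0 + φ b * φ (v 1) * w 1 :=
        ⟨_, mul_div_cancel₀ _ hm'⟩
      refine ⟨![(φ m * x + φ c * φ (v 2) * w 2) / φ e, (w 2 - φ (v 2) * x) / φ e,
        (φ (v 0) * w 1 - φ (v 1) * w 0) / φ m], ?_⟩
      have h1 : φ m * x ^ 2 + φ a * φ b * φ m * ((φ (v 0) * w 1 - φ (v 1) * w 0) / φ m) ^ 2
          = φ a * w 0 ^ 2 + φ b * w 1 ^ 2 := by
        apply mul_left_cancel₀ hm'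
        field_simp
        have : φ m ^ 2 * x ^ 2 = (φ a * φ (v 0) * w 0 + φ b * φ (v 1) * w 1) ^ 2 := by
          rw [← hx]; ring
        rw [this, hm2]
        ring
      have h3 : φ e * ((φ m * x + φ c * φ (v 2) * w 2) / φ e) ^ 2
          + φ m * φ c * φ e * ((w 2 - φ (v 2) * x) / φ e) ^ 2 = φ m * x ^ 2 + φ c * w 2 ^ 2 := by
        apply mul_left_cancel₀ he'
        field_simp
        rw [he2]
        ring
      simp only [Fin.sum_univ_three, Matrix.cons_val_zero, Matrix.cons_val_one,
        Matrix.cons_val, map_mul]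
      linear_combination h1 + h3 + hw

end Diagonalization

/-! ### Generic values of ternary forms over `k(z)(y)(x)`. -/

section IteratedRationalFunctions

variable {k : Type u} [Field k]

theorem ratFunc_two_ne_zero (h2 : (2 : k) ≠ 0) : (2 : RatFunc k) ≠ 0 := by
  rw [← map_ofNat (RatFunc.C (K := k)) 2]
  exact (map_ne_zero _).2 h2

/-- If an anisotropic ternary form `⟨a, b, c⟩` represents `e₀ x² + e₁ y² + e₂ z²` over `k(z)(y)(x)`
then it has the same discriminant as `⟨e₀, e₁, e₂⟩`. -/
theorem mul_isSquare_of_represents_sum_sq (h2 : (2 : k) ≠ 0) {a b c e₀ e₁ e₂ : k}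
    (habc : DiagAnisotropic ![a, b, c]) (h₀ : e₀ ≠ 0) (h₁ : e₁ ≠ 0)
    (h : DiagRepresents (fun i => RatFunc.C (RatFunc.C (RatFunc.C (![a, b, c] i))))
      (RatFunc.C (RatFunc.C (RatFunc.C e₀)) * RatFunc.X ^ 2 +
        RatFunc.C (RatFunc.C (RatFunc.C e₁) * RatFunc.X ^ 2 +
          RatFunc.C (RatFunc.C e₂ * RatFunc.X ^ 2)))) :
    IsSquare (e₀ * e₁ * e₂ * (a * b * c)) := by
  have r0 : DiagRepresents ![a, b, c] e₀ :=
    habc.represents_const (habc.ratFunc.represents_const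
      (habc.ratFunc.ratFunc.represents_leadingCoeff h))
  -- Split `e₀` off and cancel it against `e₀ x²`, then do the same with `e₁`. What is left is a
  -- unary form representing `e₂`, which identifies the discriminants.
  obtain ⟨b', c', t, ht, han, hdom⟩ := ternary_split habc r0 h₀
  have h' : DiagRepresents (fun i => RatFunc.C (RatFunc.C (![b', c'] i)))
      (RatFunc.C (RatFunc.C e₁) * RatFunc.X ^ 2 + RatFunc.C (RatFunc.C e₂ * RatFunc.X ^ 2)) :=
    han.ratFunc.ratFunc.represents_tail (ratFunc_two_ne_zero (ratFunc_two_ne_zero h2))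
      (hdom _ (RatFunc.C.comp (RatFunc.C.comp RatFunc.C)) _ h)
  have hbc : DiagAnisotropic ![b', c'] := by
    intro v hv i
    have := han (Fin.cons 0 v) (by
      rw [Fin.sum_univ_succ]
      simpa using hv) i.succ
    simpa using this
  have r1 : DiagRepresents ![b', c'] e₁ :=
    hbc.represents_const (hbc.ratFunc.represents_leadingCoeff h')
  obtain ⟨han', hdom'⟩ := binary_split hbc r1 h₁
  have h'' : DiagRepresents (fun i => RatFunc.C (![b' * c' * e₁] i))
      (RatFunc.C e₂ * RatFunc.X ^ 2) :=
    han'.ratFunc.represents_tail (ratFunc_two_ne_zero h2)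
      (hdom' _ (RatFunc.C.comp RatFunc.C) _ h')
  have hc : DiagAnisotropic ![b' * c' * e₁] := by
    intro v hv i
    have := han' (Fin.cons 0 v) (by
      rw [Fin.sum_univ_succ]
      simpa using hv) i.succ
    simpa using this
  obtain ⟨v, hv⟩ := hc.represents_leadingCoeff (e := e₂) (c := 0) (by simpa using h'')
  simp only [Finset.univ_unique, Fin.default_eq_zero, Fin.isValue, Matrix.cons_val_fin_one,
    Finset.sum_singleton] at hv
  have hbc0 : b' * c' * e₁ ≠ 0 := by simpa using hc.ne_zero 0
  have hb'c' : b' * c' ≠ 0 := left_ne_zero_of_mul hbc0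
  refine ⟨e₁ * v 0 * t, ?_⟩
  rw [← hv]
  linear_combination e₁ ^ 2 * v 0 ^ 2 * ht

/-- A nondegenerate ternary form in three variables is not represented by a unary form. -/
theorem sum_sq_not_represented (h2 : (2 : k) ≠ 0) {c e₀ e₁ e₂ : k} (hc : c ≠ 0)
    (h₀ : e₀ ≠ 0) (h₁ : e₁ ≠ 0)
    (h : DiagRepresents (fun i => RatFunc.C (RatFunc.C (RatFunc.C (![c] i))))
      (RatFunc.C (RatFunc.C (RatFunc.C e₀)) * RatFunc.X ^ 2 +
        RatFunc.C (RatFunc.C (RatFunc.C e₁) * RatFunc.X ^ 2 +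
          RatFunc.C (RatFunc.C e₂ * RatFunc.X ^ 2)))) : False := by
  have hc1 : ∀ {e : k}, e ≠ 0 → DiagAnisotropic ![e] := by
    intro e he v hv i
    simpa [he, Fin.fin_one_eq_zero i] using hv
  have hca := hc1 hc
  have hr : DiagRepresents ![c] e₀ :=
    hca.represents_const (hca.ratFunc.represents_const
      (hca.ratFunc.ratFunc.represents_leadingCoeff h))
  -- After `e₀` is split off the unary form, the tail is the empty form, whose only value is zero.
  have hempty : DiagAnisotropic (fun i : Fin 0 => ![e₀] i.succ) := fun _ _ i => i.elim0
  have h' : DiagRepresents (fun i : Fin 0 => RatFunc.C (RatFunc.C (![e₀] i.succ)))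
      (RatFunc.C (RatFunc.C e₁) * RatFunc.X ^ 2 + RatFunc.C (RatFunc.C e₂ * RatFunc.X ^ 2)) :=
    (hc1 h₀).ratFunc.ratFunc.represents_tail (ratFunc_two_ne_zero (ratFunc_two_ne_zero h2))
      (unary_split hr h₀ _ (RatFunc.C.comp (RatFunc.C.comp RatFunc.C)) _ h)
  obtain ⟨w, hw⟩ := hempty.represents_const (hempty.ratFunc.represents_leadingCoeff h')
  exact h₁ (by rw [← hw]; exact Fin.sum_univ_zero _)

end IteratedRationalFunctions

/-! ### Transfer from iterated rational functions to polynomials. -/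

section PolynomialsInThreeVariables

variable {k : Type u} [Field k]

theorem MvPolynomial.exists_ratFunc_embedding {n : ℕ} {L : Type*} [Field L]
    (f : MvPolynomial (Fin n) k →+* L) (hf : Function.Injective f) :
    ∃ g : MvPolynomial (Fin (n + 1)) k →+* RatFunc L, Function.Injective g ∧
      (∀ r, g (MvPolynomial.C r) = RatFunc.C (f (MvPolynomial.C r))) ∧
      g (MvPolynomial.X 0) = RatFunc.X ∧
      ∀ i : Fin n, g (MvPolynomial.X i.succ) = RatFunc.C (f (MvPolynomial.X i)) := by
  refine ⟨(algebraMap (Polynomial L) (RatFunc L)).comp ((Polynomial.mapRingHom f).comp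
    (MvPolynomial.finSuccEquiv k n : MvPolynomial (Fin (n + 1)) k →+* _)), ?_, ?_, ?_, ?_⟩
  · rw [RingHom.coe_comp, RingHom.coe_comp]
    refine (RatFunc.algebraMap_injective L).comp (Function.Injective.comp ?_ ?_)
    · exact Polynomial.map_injective f hf
    · exact (MvPolynomial.finSuccEquiv k n).injective
  · intro r
    simp [MvPolynomial.finSuccEquiv_apply]
  · simp [MvPolynomial.finSuccEquiv_X_zero]
  · intro i
    simp [MvPolynomial.finSuccEquiv_X_succ]

/-- The variable `X 0` becomes the outermost one, matching the order in which coefficients are split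
off. -/
theorem MvPolynomial.exists_iterated_ratFunc_embedding (k : Type u) [Field k] :
    ∃ g : MvPolynomial (Fin 3) k →+* RatFunc (RatFunc (RatFunc k)), Function.Injective g ∧
      (∀ r, g (MvPolynomial.C r) = RatFunc.C (RatFunc.C (RatFunc.C r))) ∧
      ∀ e : Fin 3 → k, g (∑ i, MvPolynomial.C (e i) * MvPolynomial.X i ^ 2) =
        RatFunc.C (RatFunc.C (RatFunc.C (e 0))) * RatFunc.X ^ 2 +
        RatFunc.C (RatFunc.C (RatFunc.C (e 1)) * RatFunc.X ^ 2 +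
          RatFunc.C (RatFunc.C (e 2) * RatFunc.X ^ 2)) := by
  obtain ⟨g₁, i₁, c₁, x₁, -⟩ := exists_ratFunc_embedding
    (MvPolynomial.isEmptyAlgEquiv k (Fin 0) : MvPolynomial (Fin 0) k →+* k)
    (MvPolynomial.isEmptyAlgEquiv k (Fin 0)).injective
  obtain ⟨g₂, i₂, c₂, x₂, s₂⟩ := exists_ratFunc_embedding g₁ i₁
  obtain ⟨g₃, i₃, c₃, x₃, s₃⟩ := exists_ratFunc_embedding g₂ i₂
  have hC : ∀ r, g₃ (MvPolynomial.C r) = RatFunc.C (RatFunc.C (RatFunc.C r)) := by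
    intro r
    rw [c₃, c₂, c₁]
    exact congrArg _ (congrArg _ (congrArg _ ((isEmptyAlgEquiv k (Fin 0)).commutes r)))
  refine ⟨g₃, i₃, hC, fun e => ?_⟩
  have h₁ : g₃ (MvPolynomial.X 1) = RatFunc.C (RatFunc.X : RatFunc (RatFunc k)) := by
    rw [← x₂]; exact s₃ 0
  have h₂ : g₃ (MvPolynomial.X 2) =
      RatFunc.C (RatFunc.C (RatFunc.X : RatFunc k)) := by
    rw [← x₁, ← s₂ 0]; exact s₃ 1
  simp only [Fin.sum_univ_three, map_add, map_mul, map_pow, hC, x₃, h₁, h₂]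
  ring

/-- The diagonal quadratic polynomial `∑ eᵢ Xᵢ²`. -/
noncomputable def diagPoly (e : Fin 3 → k) : MvPolynomial (Fin 3) k :=
  ∑ i, MvPolynomial.C (e i) * MvPolynomial.X i ^ 2

theorem DiagAnisotropic.of_injective {ι R S : Type*} [Fintype ι] [CommRing R] [CommRing S]
    {b : ι → R} (f : R →+* S) (hf : Function.Injective f) (h : DiagAnisotropic fun i => f (b i)) :
    DiagAnisotropic b := by
  intro v hv i
  apply hf
  rw [map_zero]
  refine h (fun i => f (v i)) ?_ i
  rw [← map_zero f, ← hv, map_sum]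
  simp

theorem DiagAnisotropic.mvPolynomial {ι : Type*} [Fintype ι] {b : ι → k}
    (h : DiagAnisotropic b) :
    DiagAnisotropic fun i => (MvPolynomial.C (b i) : MvPolynomial (Fin 3) k) := by
  obtain ⟨g, hg, hC, -⟩ := MvPolynomial.exists_iterated_ratFunc_embedding k
  refine DiagAnisotropic.of_injective g hg ?_
  simp only [hC]
  exact h.ratFunc.ratFunc.ratFunc

theorem DiagRepresents.of_mul_sq {ι L : Type*} [Fintype ι] [Field L] {b : ι → L} {f s : L}
    (hs : s ≠ 0) (h : DiagRepresents b (f * s ^ 2)) : DiagRepresents b f := by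
  obtain ⟨v, hv⟩ := h
  refine ⟨fun i => v i / s, mul_right_cancel₀ (pow_ne_zero 2 hs) ?_⟩
  rw [← hv, Finset.sum_mul]
  refine Finset.sum_congr rfl fun i _ => ?_
  rw [mul_assoc, ← mul_pow, div_mul_cancel₀ _ hs]

/-- For `B ≠ 0`, division by `B²` would make a unary form represent a generic ternary value. With `c
= 1` this says that the diagonal polynomial has no square root among rational functions. -/
theorem eq_zero_of_C_mul_sq_eq_diagPoly_mul_sq (h2 : (2 : k) ≠ 0) {c : k} {e : Fin 3 → k}
    (hc : c ≠ 0) (he : ∀ i, e i ≠ 0) {A B : MvPolynomial (Fin 3) k}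
    (h : MvPolynomial.C c * A ^ 2 = diagPoly e * B ^ 2) : B = 0 := by
  by_contra hB
  obtain ⟨g, hg, hC, he'⟩ := MvPolynomial.exists_iterated_ratFunc_embedding k
  have hgB : g B ≠ 0 := by rwa [ne_eq, map_eq_zero_iff g hg]
  refine sum_sq_not_represented h2 (e₂ := e 2) hc (he 0) (he 1)
    (DiagRepresents.of_mul_sq hgB ⟨fun _ => g A, ?_⟩)
  have := congrArg g h
  rw [diagPoly, map_mul, map_mul, he', hC, map_pow, map_pow] at this
  rw [← this]
  exact Fin.sum_univ_one _

theorem isSquare_of_sum_C_mul_sq_eq_diagPoly_mul_sq (h2 : (2 : k) ≠ 0) {a b c : k}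
    {e : Fin 3 → k} (habc : DiagAnisotropic ![a, b, c]) (he : ∀ i, e i ≠ 0)
    {p q r s : MvPolynomial (Fin 3) k} (hs : s ≠ 0)
    (h : MvPolynomial.C a * p ^ 2 + MvPolynomial.C b * q ^ 2 + MvPolynomial.C c * r ^ 2
      = diagPoly e * s ^ 2) : IsSquare (e 0 * e 1 * e 2 * (a * b * c)) := by
  obtain ⟨g, hg, hC, he'⟩ := MvPolynomial.exists_iterated_ratFunc_embedding k
  have hgs : g s ≠ 0 := by rwa [ne_eq, map_eq_zero_iff g hg]
  refine mul_isSquare_of_represents_sum_sq h2 habc (he 0) (he 1)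
    (DiagRepresents.of_mul_sq hgs ⟨![g p, g q, g r], ?_⟩)
  have := congrArg g h
  rw [diagPoly, map_mul, he'] at this
  simp only [map_add, map_mul, map_pow, hC] at this
  simp only [Fin.sum_univ_three, Matrix.cons_val_zero, Matrix.cons_val_one, Matrix.cons_val]
  rw [this]
  simp only [map_add, map_mul, map_pow]

end PolynomialsInThreeVariables

/-! ### The function field of a quadric as the field generated by a generic point. -/

section QuadricFunctionField

open MvPolynomial

variable {M : Type u} {Ω : Type*} [Field M] [Field Ω] [Algebra M Ω]

/-- For the quadric `w₀ X₀² + ⋯ + w₃ X₃² = 0`, the coefficients of `X₀²` in terms of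
`X₁², X₂², X₃²`. -/
def solvedCoeff (w : Fin 4 → M) (i : Fin 3) : M := -(w i.succ) / w 0

theorem solvedCoeff_ne_zero {w : Fin 4 → M} (hw : ∀ i, w i ≠ 0) (i : Fin 3) :
    solvedCoeff w i ≠ 0 := div_ne_zero (neg_ne_zero.2 (hw _)) (hw 0)

theorem sq_eq_aeval_diagPoly {w : Fin 4 → M} (hw : ∀ i, w i ≠ 0) {z : Fin 4 → Ω}
    (hq : ∑ i, algebraMap M Ω (w i) * z i ^ 2 = 0) :
    z 0 ^ 2 = aeval (fun i : Fin 3 => z i.succ) (diagPoly (solvedCoeff w)) := by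
  have h0 : algebraMap M Ω (w 0) ≠ 0 := (map_ne_zero _).2 (hw 0)
  rw [Fin.sum_univ_succ] at hq
  apply mul_left_cancel₀ h0
  rw [eq_neg_of_add_eq_zero_left hq]
  simp only [diagPoly, map_sum, map_mul, map_pow, aeval_C, aeval_X, solvedCoeff, map_div₀, map_neg,
    Finset.mul_sum]
  rw [← Finset.sum_neg_distrib]
  refine Finset.sum_congr rfl fun i _ => ?_
  field_simp

theorem exists_linear_rep_mod_quadric {w : Fin 4 → M} (hw : ∀ i, w i ≠ 0)
    (p : MvPolynomial (Fin 4) M) : ∃ A B : MvPolynomial (Fin 3) M,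
      p - (rename Fin.succ A + rename Fin.succ B * X 0) ∈
        Ideal.span {∑ i, C (w i) * X i ^ 2} := by
  induction p using MvPolynomial.induction_on with
  | C r => exact ⟨C r, 0, by simp⟩
  | add p q hp hq =>
    obtain ⟨A, B, h⟩ := hp
    obtain ⟨A', B', h'⟩ := hq
    refine ⟨A + A', B + B', ?_⟩
    convert Ideal.add_mem _ h h' using 1
    rw [map_add, map_add]
    ring
  | mul_X p i hp =>
    obtain ⟨A, B, h⟩ := hp
    refine Fin.cases ?_ (fun i => ?_) i
    · refine ⟨B * diagPoly (solvedCoeff w), A, ?_⟩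
      have hd : X 0 ^ 2 - rename Fin.succ (diagPoly (solvedCoeff w)) ∈
          Ideal.span {∑ i, C (w i) * X i ^ 2} := by
        refine Ideal.mem_span_singleton.2 ⟨C (w 0)⁻¹, ?_⟩
        rw [Fin.sum_univ_succ, add_mul, mul_right_comm, ← C_mul, mul_inv_cancel₀ (hw 0), C_1,
          one_mul, sub_eq_add_neg, Finset.sum_mul, diagPoly, map_sum, ← Finset.sum_neg_distrib]
        refine congrArg _ (Finset.sum_congr rfl fun i _ => ?_)
        rw [solvedCoeff, map_mul, map_pow, rename_C, rename_X, mul_right_comm, ← C_mul, neg_div,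
          C_neg, div_eq_mul_inv]
        ring
      convert Ideal.add_mem _ (Ideal.mul_mem_right (X 0) _ h)
        (Ideal.mul_mem_left _ (rename Fin.succ B) hd) using 1
      rw [map_mul]
      ring
    · refine ⟨A * X i, B * X i, ?_⟩
      convert Ideal.mul_mem_right (X i.succ) _ h using 1
      rw [map_mul, map_mul, rename_X]
      ring

theorem exists_aeval_eq_add_mul {w : Fin 4 → M} (hw : ∀ i, w i ≠ 0) {z : Fin 4 → Ω}
    (hq : ∑ i, algebraMap M Ω (w i) * z i ^ 2 = 0) (p : MvPolynomial (Fin 4) M) :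
    ∃ A B : MvPolynomial (Fin 3) M,
      p - (rename Fin.succ A + rename Fin.succ B * X 0) ∈ Ideal.span {∑ i, C (w i) * X i ^ 2} ∧
      aeval z p = aeval (fun i : Fin 3 => z i.succ) A +
        aeval (fun i : Fin 3 => z i.succ) B * z 0 := by
  obtain ⟨A, B, h⟩ := exists_linear_rep_mod_quadric hw p
  refine ⟨A, B, h, ?_⟩
  obtain ⟨q, hq'⟩ := Ideal.mem_span_singleton.1 h
  have h1 := congrArg (aeval z) hq'
  rw [map_mul, map_sub, map_add, map_mul, aeval_X, aeval_rename, aeval_rename, map_sum] at h1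
  simp only [map_mul, map_pow, aeval_C, aeval_X, hq, zero_mul] at h1
  exact sub_eq_zero.1 h1

/-- Since `z₀² = d(z₁, z₂, z₃)`, the relation gives `A² = d B²`, and `d` is not a square. Hence `1`
and `z₀` are independent over the polynomials in the other coordinates. -/
theorem eq_zero_of_add_mul_eq_zero (h2 : (2 : M) ≠ 0) {w : Fin 4 → M} (hw : ∀ i, w i ≠ 0)
    {z : Fin 4 → Ω} (hz : AlgebraicIndependent M fun i : Fin 3 => z i.succ)
    (hq : ∑ i, algebraMap M Ω (w i) * z i ^ 2 = 0) {A B : MvPolynomial (Fin 3) M}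
    (h : aeval (fun i : Fin 3 => z i.succ) A + aeval (fun i : Fin 3 => z i.succ) B * z 0 = 0) :
    A = 0 ∧ B = 0 := by
  have hB : B = 0 := by
    refine eq_zero_of_C_mul_sq_eq_diagPoly_mul_sq (A := A) h2 one_ne_zero
      (solvedCoeff_ne_zero hw) (hz ?_)
    simp only [map_mul, map_pow, C_1, one_mul, ← sq_eq_aeval_diagPoly hw hq]
    rw [eq_neg_of_add_eq_zero_left h]
    ring
  refine ⟨hz ?_, hB⟩
  rw [hB, map_zero, zero_mul, add_zero] at h
  rw [h, map_zero]

/-- Modulo the quadric every polynomial is `A + B X₀`, and such an expression vanishes at the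
generic point only if `A = B = 0`. -/
theorem ker_aeval_eq_span (h2 : (2 : M) ≠ 0) {w : Fin 4 → M} (hw : ∀ i, w i ≠ 0)
    {z : Fin 4 → Ω} (hz : AlgebraicIndependent M fun i : Fin 3 => z i.succ)
    (hq : ∑ i, algebraMap M Ω (w i) * z i ^ 2 = 0) :
    RingHom.ker (aeval z : MvPolynomial (Fin 4) M →ₐ[M] Ω) =
      Ideal.span {∑ i, C (w i) * X i ^ 2} := by
  apply le_antisymm
  · intro p hp
    obtain ⟨A, B, hAB, h⟩ := exists_aeval_eq_add_mul hw hq p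
    obtain ⟨rfl, rfl⟩ := eq_zero_of_add_mul_eq_zero h2 hw hz hq (h.symm.trans hp)
    simpa using hAB
  · rw [Ideal.span_le, Set.singleton_subset_iff, SetLike.mem_coe, RingHom.mem_ker]
    simpa using hq

open scoped IntermediateField.algebraAdjoinAdjoin in
theorem nonempty_bigFunctionField_algEquiv (h2 : (2 : M) ≠ 0) {w : Fin 4 → M} (hw : ∀ i, w i ≠ 0)
    {z : Fin 4 → Ω} (hz : AlgebraicIndependent M fun i : Fin 3 => z i.succ)
    (hq : ∑ i, algebraMap M Ω (w i) * z i ^ 2 = 0) :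
    Nonempty (BigFunctionField M w ≃ₐ[M] IntermediateField.adjoin M (Set.range z)) := by
  have e : (MvPolynomial (Fin 4) M ⧸ Ideal.span {∑ i, C (w i) * X i ^ 2}) ≃ₐ[M]
      Algebra.adjoin M (Set.range z) :=
    (Ideal.quotientEquivAlgOfEq M (ker_aeval_eq_span h2 hw hz hq).symm).trans
      ((Ideal.quotientKerEquivRange (aeval (R := M) z)).trans
        (Subalgebra.equivOfEq _ _ (Algebra.adjoin_range_eq_range_aeval M z).symm))
  have : IsDomain (MvPolynomial (Fin 4) M ⧸ Ideal.span {∑ i, C (w i) * X i ^ 2}) :=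
    e.toMulEquiv.isDomain _
  exact ⟨IsFractionRing.algEquivOfAlgEquiv e⟩

end QuadricFunctionField

/-! ### Forms that stay anisotropic over the function field of a quadric. -/

section AnisotropyOverQuadricFunctionField

open MvPolynomial

variable {M : Type u} {Ω : Type*} [Field M] [Field Ω] [Algebra M Ω]

open scoped IntermediateField.algebraAdjoinAdjoin in
/-- Anisotropy over the function field `M(z)` of a quadric reduces to a statement about polynomials
`A + B √d` in three variables. -/
theorem DiagAnisotropic.adjoin_of_polynomial (h2 : (2 : M) ≠ 0) {w : Fin 4 → M}
    (hw : ∀ i, w i ≠ 0) {z : Fin 4 → Ω} (hz : AlgebraicIndependent M fun i : Fin 3 => z i.succ)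
    (hq : ∑ i, algebraMap M Ω (w i) * z i ^ 2 = 0) {ι : Type*} [Fintype ι] {b : ι → M}
    (hb : ∀ A B : ι → MvPolynomial (Fin 3) M,
      ∑ i, C (b i) * A i ^ 2 + diagPoly (solvedCoeff w) * ∑ i, C (b i) * B i ^ 2 = 0 →
      ∑ i, C (b i) * (A i * B i) = 0 → ∀ i, A i = 0 ∧ B i = 0) :
    DiagAnisotropic fun i => algebraMap M (IntermediateField.adjoin M (Set.range z)) (b i) := by
  intro v hv i
  obtain ⟨s, hs⟩ := IsLocalization.exist_integer_multiples_of_finite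
    (nonZeroDivisors (Algebra.adjoin M (Set.range z))) v
  choose u hu using hs
  have hu' : ∀ i, ((u i : Algebra.adjoin M (Set.range z)) : Ω) =
      (s : Algebra.adjoin M (Set.range z)) * (v i : Ω) := by
    intro i
    have := congrArg (algebraMap (IntermediateField.adjoin M (Set.range z)) Ω) (hu i)
    rw [Algebra.smul_def, map_mul] at this
    exact this
  have hs0 : ((s : Algebra.adjoin M (Set.range z)) : Ω) ≠ 0 := by
    intro h
    exact nonZeroDivisors.coe_ne_zero s (Subtype.ext h)
  have hmem : ∀ i, ∃ p : MvPolynomial (Fin 4) M, aeval z p = (u i : Ω) := by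
    intro i
    have : (u i : Ω) ∈ (aeval z : MvPolynomial (Fin 4) M →ₐ[M] Ω).range := by
      rw [← Algebra.adjoin_range_eq_range_aeval]
      exact (u i).2
    exact this
  choose p hp using hmem
  choose A B hAB using fun i => exists_aeval_eq_add_mul hw hq (p i)
  have hsum : ∑ i, algebraMap M Ω (b i) * (u i : Ω) ^ 2 = 0 := by
    have h := congrArg (algebraMap (IntermediateField.adjoin M (Set.range z)) Ω) hv
    rw [map_sum, map_zero] at h
    rw [← mul_zero (((s : Algebra.adjoin M (Set.range z)) : Ω) ^ 2), ← h, Finset.mul_sum]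
    refine Finset.sum_congr rfl fun i _ => ?_
    rw [hu' i, map_mul, map_pow, ← IsScalarTower.algebraMap_apply]
    simp only [IntermediateField.algebraMap_apply]
    ring
  -- Expanding `∑ bᵢ (Aᵢ + Bᵢ z₀)²` with `z₀² = d`, the constant part and the coefficient of `z₀`
  -- vanish separately.
  obtain ⟨h1, h3⟩ := eq_zero_of_add_mul_eq_zero h2 hw hz hq
    (A := ∑ i, C (b i) * A i ^ 2 + diagPoly (solvedCoeff w) * ∑ i, C (b i) * B i ^ 2)
    (B := C 2 * ∑ i, C (b i) * (A i * B i)) (by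
      rw [← hsum]
      simp only [map_add, map_mul, map_sum, map_pow, aeval_C, ← hp, (hAB _).2,
        ← sq_eq_aeval_diagPoly hw hq, Finset.mul_sum, Finset.sum_mul, map_ofNat]
      rw [← Finset.sum_add_distrib, ← Finset.sum_add_distrib]
      exact Finset.sum_congr rfl fun i _ => by ring)
  have h4 := hb A B h1
    ((mul_eq_zero.1 h3).resolve_left fun h => h2 (C_eq_zero.1 h)) i
  have h5 : (u i : Ω) = 0 := by
    rw [← hp, (hAB i).2, h4.1, h4.2]
    simp
  rw [hu' i] at h5
  exact Subtype.ext ((mul_eq_zero.1 h5).resolve_left hs0)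

/-- Suppose `(A₀ + B₀√d)² = c (A₁ + B₁√d)²`. Multiplying by the square of the conjugate of `A₁ +
B₁√d` gives `(P + Q√d)² = c U²` with `U = A₁² - d B₁²`. The cross term forces `PQ = 0`. If `P = 0`
then `d Q² = c U²`; if `Q = 0` then `P² = c U²`. Either way `U = 0`, so `A₁ = B₁ = 0`. -/
theorem DiagAnisotropic.adjoin_binary (h2 : (2 : M) ≠ 0) {w : Fin 4 → M}
    (hw : ∀ i, w i ≠ 0) {z : Fin 4 → Ω} (hz : AlgebraicIndependent M fun i : Fin 3 => z i.succ)
    (hq : ∑ i, algebraMap M Ω (w i) * z i ^ 2 = 0) {c : M} (hc : DiagAnisotropic ![1, -c]) :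
    DiagAnisotropic fun i =>
      algebraMap M (IntermediateField.adjoin M (Set.range z)) (![1, -c] i) := by
  have hc0 : c ≠ 0 := neg_ne_zero.1 (by simpa using hc.ne_zero 1)
  refine DiagAnisotropic.adjoin_of_polynomial h2 hw hz hq fun A B h1 h3 => ?_
  obtain ⟨d, hd⟩ : ∃ d, d = diagPoly (solvedCoeff w) := ⟨_, rfl⟩
  rw [← hd] at h1
  simp only [Fin.sum_univ_two, Matrix.cons_val_zero, Matrix.cons_val_one, C_neg, C_1] at h1 h3
  have hsq : ∀ {P Q : MvPolynomial (Fin 3) M} {e : M}, e ≠ 0 → C e * P ^ 2 = d * Q ^ 2 → Q = 0 := by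
    intro P Q e he h
    rw [hd] at h
    exact eq_zero_of_C_mul_sq_eq_diagPoly_mul_sq h2 he (solvedCoeff_ne_zero hw) h
  have hpair : ∀ {P Q : MvPolynomial (Fin 3) M} {e : M}, e ≠ 0 →
      C e * P ^ 2 = d * Q ^ 2 → P = 0 ∧ Q = 0 := by
    intro P Q e he h
    have hQ := hsq he h
    rw [hQ] at h
    refine ⟨?_, hQ⟩
    have : C e * P ^ 2 = 0 := by rw [h]; ring
    exact eq_zero_of_pow_eq_zero
      ((mul_eq_zero.1 this).resolve_left fun h => he (C_eq_zero.1 h))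
  have hc' : ∀ {P U : MvPolynomial (Fin 3) M}, P ^ 2 = C c * U ^ 2 → U = 0 := by
    intro P U h
    have := hc.mvPolynomial ![P, U] (by
      simp only [Fin.sum_univ_two, Matrix.cons_val_zero, Matrix.cons_val_one, C_neg, C_1]
      rw [h]
      ring) 1
    simpa using this
  have hU : A 1 ^ 2 - d * B 1 ^ 2 = 0 := by
    have hPQ : (A 0 * A 1 - d * (B 0 * B 1)) * (B 0 * A 1 - A 0 * B 1) = 0 := by
      linear_combination (A 1 ^ 2 + d * B 1 ^ 2) * h3 - A 1 * B 1 * h1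
    have hN : (A 0 * A 1 - d * (B 0 * B 1)) ^ 2 + d * (B 0 * A 1 - A 0 * B 1) ^ 2
        = C c * (A 1 ^ 2 - d * B 1 ^ 2) ^ 2 := by
      linear_combination (A 1 ^ 2 + d * B 1 ^ 2) * h1 - 4 * d * A 1 * B 1 * h3
    rcases mul_eq_zero.1 hPQ with h | h
    · rw [h] at hN
      exact (hpair (Q := B 0 * A 1 - A 0 * B 1) hc0 (by linear_combination -hN)).1
    · rw [h] at hN
      exact hc' (P := A 0 * A 1 - d * (B 0 * B 1)) (by linear_combination hN)
  obtain ⟨hA1, hB1⟩ := hpair (P := A 1) (Q := B 1) (e := 1) one_ne_zero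
    (by rw [C_1]; linear_combination hU)
  rw [hA1, hB1] at h1 h3
  have hAB : A 0 * B 0 = 0 := by linear_combination h3
  have h5 : A 0 = 0 ∧ B 0 = 0 := by
    rcases mul_eq_zero.1 hAB with h | h
    · refine ⟨h, hsq (P := 0) (e := 1) one_ne_zero ?_⟩
      rw [h] at h1
      linear_combination -h1
    · refine ⟨?_, h⟩
      rw [h] at h1
      exact eq_zero_of_pow_eq_zero (n := 2) (by linear_combination h1)
  intro i
  fin_cases i
  · exact h5
  · exact ⟨hA1, hB1⟩

/-- A quaternion norm form stays anisotropic over the function field of a four-dimensional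
quadric of nontrivial discriminant. -/
theorem DiagAnisotropic.adjoin_quaternionNorm (h2 : (2 : M) ≠ 0) {w : Fin 4 → M}
    (hw : ∀ i, w i ≠ 0) (hdisc : ¬ IsSquare (∏ i, w i))
    {z : Fin 4 → Ω} (hz : AlgebraicIndependent M fun i : Fin 3 => z i.succ)
    (hq : ∑ i, algebraMap M Ω (w i) * z i ^ 2 = 0) {a b : M}
    (hab : DiagAnisotropic ![1, -a, -b, a * b]) :
    DiagAnisotropic fun i =>
      algebraMap M (IntermediateField.adjoin M (Set.range z)) (![1, -a, -b, a * b] i) := by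
  have ha : a ≠ 0 := neg_ne_zero.1 (by simpa using hab.ne_zero 1)
  have hb : b ≠ 0 := neg_ne_zero.1 (by simpa using hab.ne_zero 2)
  have hpure : DiagAnisotropic ![a, b, -(a * b)] := by
    intro v hv i
    have h := hab ![0, v 0, v 1, v 2] (by
      simp only [Fin.sum_univ_four, Fin.sum_univ_three, Matrix.cons_val_zero, Matrix.cons_val_one,
        Matrix.cons_val] at hv ⊢
      linear_combination -hv)
    fin_cases i
    · exact h 1
    · exact h 2
    · exact h 3
  refine DiagAnisotropic.adjoin_of_polynomial h2 hw hz hq fun u v h1 h3 => ?_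
  have hR := hab.mvPolynomial
  by_cases hv : ∑ i, C (![1, -a, -b, a * b] i) * v i ^ 2 = 0
  · have hv0 := hR v hv
    rw [hv, mul_zero, add_zero] at h1
    exact fun i => ⟨hR u h1 i, hv0 i⟩
  · exfalso
    obtain ⟨d, hd⟩ : ∃ d, d = diagPoly (solvedCoeff w) := ⟨_, rfl⟩
    -- With `N` the norm form, a zero `u + v√d` satisfies `N(u) = -d N(v)` and has `u`, `v`
    -- orthogonal. Thus `u v̄` is a pure quaternion of norm `-d N(v)²`; its coordinates are `p, q,
    -- r`, and the form `⟨a, b, -ab⟩` is minus the norm on pure quaternions.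
    obtain ⟨t, ht⟩ := isSquare_of_sum_C_mul_sq_eq_diagPoly_mul_sq h2 hpure
      (solvedCoeff_ne_zero hw) hv
      (p := u 1 * v 0 - u 0 * v 1 + C b * (u 2 * v 3 - u 3 * v 2))
      (q := u 2 * v 0 - u 0 * v 2 - C a * (u 1 * v 3 - u 3 * v 1))
      (r := u 3 * v 0 - u 0 * v 3 - (u 1 * v 2 - u 2 * v 1)) (by
        rw [← hd] at h1 ⊢
        simp only [Fin.sum_univ_four, Matrix.cons_val_zero, Matrix.cons_val_one,
          Matrix.cons_val, C_neg, C_1, C_mul] at h1 h3 ⊢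
        linear_combination (u 0 * v 0 - C a * (u 1 * v 1) - C b * (u 2 * v 2)
          + C a * C b * (u 3 * v 3)) * h3 - (v 0 ^ 2 - C a * v 1 ^ 2 - C b * v 2 ^ 2
          + C a * C b * v 3 ^ 2) * h1)
    apply hdisc
    refine ⟨t * w 0 ^ 2 / (a * b), ?_⟩
    have h0 := hw 0
    simp only [solvedCoeff] at ht
    rw [Fin.prod_univ_four]
    have : w 0 * w 1 * w 2 * w 3 = (t * t) * (w 0 ^ 2 / (a * b)) ^ 2 := by
      rw [← ht]
      field_simp
      rfl
    rw [this]
    ring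

end AnisotropyOverQuadricFunctionField

/-! ### Norm forms, quaternion bases and algebras with a common slot. -/

section QuaternionAlgebras

variable {k : Type*} [Field k] {a b : k}

/-- The reduced norm of a quaternion. -/
def reducedNorm (q : ℍ[k, a, b]) : k :=
  q.re ^ 2 - a * q.imI ^ 2 - b * q.imJ ^ 2 + a * b * q.imK ^ 2

theorem mul_star_eq_reducedNorm (q : ℍ[k, a, b]) :
    q * star q = algebraMap k _ (reducedNorm q) := by
  rw [QuaternionAlgebra.algebraMap_eq]
  ext <;> simp [reducedNorm] <;> ring

theorem star_mul_eq_reducedNorm (q : ℍ[k, a, b]) :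
    star q * q = algebraMap k _ (reducedNorm q) := by
  rw [QuaternionAlgebra.algebraMap_eq]
  ext <;> simp [reducedNorm] <;> ring

theorem eq_zero_of_reducedNorm_eq_zero (h : DiagAnisotropic ![1, -a, -b, a * b])
    {q : ℍ[k, a, b]} (hq : reducedNorm q = 0) : q = 0 := by
  have h' := h ![q.re, q.imI, q.imJ, q.imK] (by
    simp only [Fin.sum_univ_four, Matrix.cons_val_zero, Matrix.cons_val_one, Matrix.cons_val]
    rw [reducedNorm] at hq
    linear_combination hq)
  ext
  · exact h' 0
  · exact h' 1
  · exact h' 2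
  · exact h' 3

theorem isUnit_of_diagAnisotropic (h : DiagAnisotropic ![1, -a, -b, a * b])
    (q : ℍ[k, a, b]) (hq : q ≠ 0) : IsUnit q := by
  have hN : reducedNorm q ≠ 0 := fun h0 => hq (eq_zero_of_reducedNorm_eq_zero h h0)
  refine ⟨⟨q, (reducedNorm q)⁻¹ • star q, ?_, ?_⟩, rfl⟩
  · rw [mul_smul_comm, mul_star_eq_reducedNorm, Algebra.smul_def, ← map_mul,
      inv_mul_cancel₀ hN, map_one]
  · rw [smul_mul_assoc, star_mul_eq_reducedNorm, Algebra.smul_def, ← map_mul,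
      inv_mul_cancel₀ hN, map_one]

theorem diagAnisotropic_of_isUnit (h : ∀ q : ℍ[k, a, b], q ≠ 0 → IsUnit q) :
    DiagAnisotropic ![1, -a, -b, a * b] := by
  intro v hv
  obtain ⟨q, hq⟩ : ∃ q : ℍ[k, a, b], q = ⟨v 0, v 1, v 2, v 3⟩ := ⟨_, rfl⟩
  have hN : q * star q = 0 := by
    simp only [Fin.sum_univ_four, Matrix.cons_val_zero, Matrix.cons_val_one,
      Matrix.cons_val] at hv
    have h0 : reducedNorm q = 0 := by
      rw [reducedNorm, hq]
      linear_combination hv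
    rw [mul_star_eq_reducedNorm, h0, map_zero]
  have hq0 : q = 0 := by
    by_contra h0
    have := (h q h0).mul_right_eq_zero.1 hN
    exact h0 (star_eq_zero.1 this)
  rw [hq] at hq0
  intro i
  fin_cases i
  · exact congrArg (fun x => x.re) hq0
  · exact congrArg (fun x => x.imI) hq0
  · exact congrArg (fun x => x.imJ) hq0
  · exact congrArg (fun x => x.imK) hq0

/-- Algebra homomorphisms out of quaternion algebras are injective. -/
theorem quaternionAlgebra_hom_injective {A : Type*} [Ring A] [Nontrivial A] [Algebra k A]
    (h2 : (2 : k) ≠ 0) (ha : a ≠ 0) (hb : b ≠ 0) (f : ℍ[k, a, b] →ₐ[k] A) :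
    Function.Injective f := by
  have key : ∀ q : ℍ[k, a, b], f q = 0 → q.re = 0 := by
    intro q hq
    obtain ⟨i, hi⟩ : ∃ i : ℍ[k, a, b], i = ⟨0, 1, 0, 0⟩ := ⟨_, rfl⟩
    obtain ⟨j, hj⟩ : ∃ j : ℍ[k, a, b], j = ⟨0, 0, 1, 0⟩ := ⟨_, rfl⟩
    obtain ⟨l, hl⟩ : ∃ l : ℍ[k, a, b], l = ⟨0, 0, 0, 1⟩ := ⟨_, rfl⟩
    -- Summing the conjugates of `q` by `1, i, j, ij` leaves four times the scalar part. Multiplying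
    -- by `ab` clears the inverses.
    have h1 : (a * b) • q + b • (i * q * i) + a • (j * q * j) - l * q * l
        = algebraMap k _ (2 * 2 * a * b * q.re) := by
      rw [hi, hj, hl, QuaternionAlgebra.algebraMap_eq]
      ext <;> simp <;> ring
    have h3 := congrArg f h1
    simp only [map_sub, map_add, map_smul, map_mul f, hq, mul_zero, zero_mul, smul_zero,
      add_zero, sub_zero, AlgHom.commutes] at h3
    have h4 := (map_eq_zero_iff _ (algebraMap k A).injective).1 h3.symm
    simpa [h2, ha, hb] using h4
  rw [injective_iff_map_eq_zero]
  intro q hq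
  have hmul : ∀ p : ℍ[k, a, b], (q * p).re = 0 := fun p => key _ (by rw [map_mul, hq, zero_mul])
  have h1 := hmul 1
  have h3 := hmul ⟨0, 1, 0, 0⟩
  have h4 := hmul ⟨0, 0, 1, 0⟩
  have h5 := hmul ⟨0, 0, 0, 1⟩
  simp [ha, hb] at h1 h3 h4 h5
  ext <;> assumption

theorem quaternionAlgebra_hom_bijective {A : Type*} [Ring A] [Algebra k A]
    (h2 : (2 : k) ≠ 0) (ha : a ≠ 0) (hb : b ≠ 0) (hA : Module.finrank k A = 4)
    (f : ℍ[k, a, b] →ₐ[k] A) : Function.Bijective f := by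
  have : Nontrivial A := Module.nontrivial_of_finrank_pos (R := k) (by omega)
  have hi := quaternionAlgebra_hom_injective h2 ha hb f
  have : FiniteDimensional k A := FiniteDimensional.of_finrank_pos (by omega)
  exact ⟨hi, (LinearMap.injective_iff_surjective_of_finrank_eq_finrank
    (f := f.toLinearMap) (by rw [hA, QuaternionAlgebra.finrank_eq_four])).1 hi⟩

/-- Anticommuting elements of a four-dimensional algebra with the right squares identify it with a
quaternion algebra. -/
theorem nonempty_quaternionAlgebra_algEquiv {A : Type*} [Ring A] [Algebra k A]
    (h2 : (2 : k) ≠ 0) (ha : a ≠ 0) (hb : b ≠ 0) (hA : Module.finrank k A = 4) {i j : A}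
    (hi : i * i = algebraMap k A a) (hj : j * j = algebraMap k A b) (hij : j * i = -(i * j)) :
    Nonempty (ℍ[k, a, b] ≃ₐ[k] A) :=
  ⟨AlgEquiv.ofBijective (QuaternionAlgebra.lift
    { i := i
      j := j
      k := i * j
      i_mul_i := by rw [hi, Algebra.algebraMap_eq_smul_one, zero_smul, add_zero]
      j_mul_j := by rw [hj, Algebra.algebraMap_eq_smul_one]
      i_mul_j := rfl
      j_mul_i := by rw [hij, zero_smul, zero_sub] })
    (quaternionAlgebra_hom_bijective h2 ha hb hA _)⟩

/-- An element of square `c` outside the center of a quaternion division algebra is part of a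
quaternion basis. -/
theorem exists_quaternionAlgebra_algEquiv_of_sq (h2 : (2 : k) ≠ 0)
    (h : DiagAnisotropic ![1, -a, -b, a * b]) {c : k} {q : ℍ[k, a, b]}
    (hq : q * q = algebraMap k _ c) (hq0 : ∀ r : k, q ≠ algebraMap k _ r) :
    c ≠ 0 ∧ ∃ d : k, d ≠ 0 ∧ Nonempty (ℍ[k, c, d] ≃ₐ[k] ℍ[k, a, b]) := by
  have ha : a ≠ 0 := neg_ne_zero.1 (by simpa using h.ne_zero 1)
  have hb : b ≠ 0 := neg_ne_zero.1 (by simpa using h.ne_zero 2)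
  have hunit := isUnit_of_diagAnisotropic h
  have hqne : q ≠ 0 := by
    intro h0
    exact hq0 0 (by rw [h0, map_zero])
  have hc : c ≠ 0 := by
    rintro rfl
    rw [map_zero] at hq
    exact hqne ((hunit q hqne).mul_right_eq_zero.1 hq)
  refine ⟨hc, ?_⟩
  have hI := congrArg (fun x => x.imI) hq
  have hJ := congrArg (fun x => x.imJ) hq
  have hK := congrArg (fun x => x.imK) hq
  simp at hI hJ hK
  -- The imaginary coordinates of `q²` are `2 q.re` times those of `q`, so a nonzero real part would
  -- make `q` a scalar.
  have hre : q.re = 0 := by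
    by_contra hr
    have h2r : 2 * q.re ≠ 0 := mul_ne_zero h2 hr
    apply hq0 q.re
    ext
    · simp
    · simpa using mul_left_cancel₀ h2r (by linear_combination hI : 2 * q.re * q.imI = 2 * q.re * 0)
    · simpa using mul_left_cancel₀ h2r (by linear_combination hJ : 2 * q.re * q.imJ = 2 * q.re * 0)
    · simpa using mul_left_cancel₀ h2r (by linear_combination hK : 2 * q.re * q.imK = 2 * q.re * 0)
  -- A pure quaternion orthogonal to the pure quaternion `q` anticommutes with it. One is chosen in
  -- the span of `i` and `j`.
  obtain ⟨p, hp0, hpq, hpre⟩ : ∃ p : ℍ[k, a, b], p ≠ 0 ∧ p * q = -(q * p) ∧ p.re = 0 := by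
    by_cases h12 : q.imI = 0 ∧ q.imJ = 0
    · refine ⟨⟨0, 1, 0, 0⟩, ?_, ?_, rfl⟩
      · intro h0
        simpa using congrArg (fun x => x.imI) h0
      · ext <;> simp [hre, h12.1, h12.2]
    · refine ⟨⟨0, b * q.imJ, -(a * q.imI), 0⟩, ?_, ?_, rfl⟩
      · intro h0
        have h3 := congrArg (fun x => x.imI) h0
        have h4 := congrArg (fun x => x.imJ) h0
        simp [ha, hb] at h3 h4
        exact h12 ⟨h4, h3⟩
      · ext <;> simp [hre] <;> ring
  have hpp : p * p = algebraMap k _ (-reducedNorm p) := by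
    rw [QuaternionAlgebra.algebraMap_eq]
    ext <;> simp [hpre, reducedNorm] <;> ring
  have hN : -reducedNorm p ≠ 0 := neg_ne_zero.2 fun h0 => hp0 (eq_zero_of_reducedNorm_eq_zero h h0)
  exact ⟨_, hN, nonempty_quaternionAlgebra_algEquiv h2 hc hN (QuaternionAlgebra.finrank_eq_four _ _ _)
    hq hpp hpq⟩

/-- A zero of the norm form of `(c, d₁ d₂)` shows that `d₁ d₂` is a norm from `k(√c)`. Rescaling `j`
by an element of `k(i)` then turns its square from `d₁` into `d₂`. -/
theorem nonempty_algEquiv_of_not_diagAnisotropic (h2 : (2 : k) ≠ 0) {c d₁ d₂ : k}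
    (h₁ : DiagAnisotropic ![1, -c, -d₁, c * d₁])
    (h : ¬ DiagAnisotropic ![1, -c, -(d₁ * d₂), c * (d₁ * d₂)]) (hd₂ : d₂ ≠ 0) :
    Nonempty (ℍ[k, c, d₂] ≃ₐ[k] ℍ[k, c, d₁]) := by
  have hc : c ≠ 0 := neg_ne_zero.1 (by simpa using h₁.ne_zero 1)
  have hd₁ : d₁ ≠ 0 := neg_ne_zero.1 (by simpa using h₁.ne_zero 2)
  have hbin : ∀ x y : k, x ^ 2 - c * y ^ 2 = 0 → x = 0 ∧ y = 0 := by
    intro x y hxy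
    have := h₁ ![x, y, 0, 0] (by
      simp only [Fin.sum_univ_four, Matrix.cons_val_zero, Matrix.cons_val_one, Matrix.cons_val]
      linear_combination hxy)
    exact ⟨this 0, this 1⟩
  simp only [DiagAnisotropic, not_forall] at h
  obtain ⟨v, hv, i, hi⟩ := h
  simp only [Fin.sum_univ_four, Matrix.cons_val_zero, Matrix.cons_val_one, Matrix.cons_val] at hv
  obtain ⟨m, hm⟩ : ∃ m, m = v 2 ^ 2 - c * v 3 ^ 2 := ⟨_, rfl⟩
  have hm0 : m ≠ 0 := by
    intro h0
    rw [h0] at hm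
    obtain ⟨h3, h4⟩ := hbin _ _ hm.symm
    rw [h3, h4] at hv
    obtain ⟨h5, h6⟩ := hbin (v 0) (v 1) (by linear_combination hv)
    apply hi
    fin_cases i <;> assumption
  refine nonempty_quaternionAlgebra_algEquiv h2 hc hd₂ (QuaternionAlgebra.finrank_eq_four _ _ _)
    (i := ⟨0, 1, 0, 0⟩)
    -- This is `α j` with `α = (v₀ + v₁ i) / (d₁ (v₂ + v₃ i))`, whose norm is `d₂ / d₁`.
    (j := ⟨0, 0, (v 0 * v 2 - c * v 1 * v 3) / (d₁ * m), (v 1 * v 2 - v 0 * v 3) / (d₁ * m)⟩)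
    ?_ ?_ ?_
  · ext <;> simp
  · ext <;> simp
    · field_simp
      rw [hm]
      have : v 0 ^ 2 - c * v 1 ^ 2 = d₁ * d₂ * m := by rw [hm]; linear_combination hv
      linear_combination (v 2 ^ 2 - c * v 3 ^ 2) * this
        + d₁ * d₂ * (v 2 ^ 2 - c * v 3 ^ 2) * hm
    · ring
  · ext <;> simp

/-- The quaternion algebra `(c, d₁ d₂)` splits if `(c, d₁)` and `(c, d₂)` are isomorphic. -/
theorem isEmpty_algEquiv_of_diagAnisotropic (h2 : (2 : k) ≠ 0) {c d₁ d₂ : k}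
    (h₂ : DiagAnisotropic ![1, -c, -d₂, c * d₂])
    (h : DiagAnisotropic ![1, -c, -(d₁ * d₂), c * (d₁ * d₂)]) :
    IsEmpty (ℍ[k, c, d₁] ≃ₐ[k] ℍ[k, c, d₂]) := by
  refine ⟨fun f => ?_⟩
  have hd : d₂ ≠ 0 := neg_ne_zero.1 (by simpa using h₂.ne_zero 2)
  obtain ⟨i, hi⟩ : ∃ i : ℍ[k, c, d₂], i = ⟨0, 1, 0, 0⟩ := ⟨_, rfl⟩
  have hii : i * i = algebraMap k _ c := by rw [hi]; ext <;> simp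
  obtain ⟨I, J, hII, hJJ, hJI⟩ : ∃ I J : ℍ[k, c, d₂], I * I = algebraMap k _ c ∧
      J * J = algebraMap k _ d₁ ∧ J * I = -(I * J) := by
    refine ⟨f ⟨0, 1, 0, 0⟩, f ⟨0, 0, 1, 0⟩, ?_, ?_, ?_⟩
    · rw [← map_mul, ← AlgEquiv.commutes f]
      congr 1
      ext <;> simp
    · rw [← map_mul, ← AlgEquiv.commutes f]
      congr 1
      ext <;> simp
    · rw [← map_mul, ← map_mul, ← map_neg]
      congr 1
      ext <;> simp
  -- An explicit Skolem–Noether conjugation: `i (I + i)` intertwines `I` and `i` because both have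
  -- square `c`. If `I = -i` this element vanishes, and `j` serves instead.
  obtain ⟨g, hg0, hg⟩ : ∃ g : ℍ[k, c, d₂], g ≠ 0 ∧ g * I = i * g := by
    by_cases hI : I = -i
    · refine ⟨⟨0, 0, 1, 0⟩, ?_, ?_⟩
      · intro h0
        simpa using congrArg (fun x => x.imJ) h0
      · rw [hI, hi]
        ext <;> simp
    · refine ⟨i * (I + i), ?_, ?_⟩
      · intro h0
        have hi0 : i ≠ 0 := by
          intro h0
          rw [hi] at h0
          simpa using congrArg (fun x => x.imI) h0
        have := (isUnit_of_diagAnisotropic h₂ i hi0).mul_right_eq_zero.1 h0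
        exact hI (eq_neg_of_add_eq_zero_left this)
      · rw [mul_assoc]
        congr 1
        rw [add_mul, hII, ← hii, mul_add, add_comm]
  obtain ⟨u, rfl⟩ := isUnit_of_diagAnisotropic h₂ g hg0
  obtain ⟨T, hT⟩ : ∃ T : ℍ[k, c, d₂], T = u * J * (↑u⁻¹ : ℍ[k, c, d₂]) := ⟨_, rfl⟩
  have hTT : T * T = algebraMap k _ d₁ := by
    rw [hT]
    calc _ = u * J * ((↑u⁻¹ : ℍ[k, c, d₂]) * u) * J * (↑u⁻¹ : ℍ[k, c, d₂]) := by
          simp only [mul_assoc]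
      _ = u * (J * J) * (↑u⁻¹ : ℍ[k, c, d₂]) := by rw [Units.inv_mul, mul_one]; simp only [mul_assoc]
      _ = _ := by rw [hJJ, ← Algebra.commutes, mul_assoc, Units.mul_inv, mul_one]
  have hTi : T * i = -(i * T) := by
    have h1 : (↑u⁻¹ : ℍ[k, c, d₂]) * i = I * (↑u⁻¹ : ℍ[k, c, d₂]) := by
      rw [Units.inv_mul_eq_iff_eq_mul, ← mul_assoc, hg, mul_assoc, Units.mul_inv, mul_one]
    rw [hT, mul_assoc, h1, ← mul_assoc, mul_assoc (u : ℍ[k, c, d₂]), hJI, mul_neg, neg_mul,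
      ← mul_assoc, hg]
    simp only [mul_assoc]
  -- Anticommuting with `i` puts `T` in the span of `j` and `ij`, so `d₁ = T² = d₂ (T_J² - c T_K²)`.
  -- Multiplied by `d₂`, this is a zero of the norm form of `(c, d₁ d₂)`.
  have hre := congrArg (fun x => x.re) hTi
  have hI := congrArg (fun x => x.imI) hTi
  have hN := congrArg (fun x => x.re) hTT
  simp [hi] at hre hI hN
  have hc : c ≠ 0 := neg_ne_zero.1 (by simpa using h₂.ne_zero 1)
  have hI0 : T.imI = 0 :=
    mul_left_cancel₀ (mul_ne_zero h2 hc) (by linear_combination hre)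
  have hre0 : T.re = 0 := mul_left_cancel₀ h2 (by linear_combination hI)
  rw [hI0, hre0] at hN
  have := h ![d₂ * T.imJ, d₂ * T.imK, 1, 0] (by
    simp only [Fin.sum_univ_four, Matrix.cons_val_zero, Matrix.cons_val_one, Matrix.cons_val]
    linear_combination d₂ * hN) 2
  simp at this

end QuaternionAlgebras

/-! ### Discriminants of hyperbolic forms. -/

section Hyperbolic

variable {k : Type*} [Field k]

theorem discr'_weightedSumSquares_fin_four [Invertible (2 : k)] (w : Fin 4 → k) :
    QuadraticForm.discr' (QuadraticMap.weightedSumSquares k w) = ∏ i, w i := by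
  rw [QuadraticForm.discr', ← Matrix.det_diagonal]
  congr 1
  ext i j
  rw [QuadraticForm.toMatrix', LinearMap.toMatrix₂'_apply, QuadraticMap.associated_apply]
  simp only [QuadraticMap.weightedSumSquares_apply, Fin.sum_univ_four, Pi.add_apply]
  have h2 : (2 : k) ≠ 0 := Invertible.ne_zero 2
  fin_cases i <;> fin_cases j <;> simp <;> field_simp <;> ring

/-- Two hyperbolic planes have discriminant `(-1)² = 1`, and an isometry changes the discriminant by
the square of a determinant. -/
theorem isSquare_prod_of_isHyperbolicForm (h2 : (2 : k) ≠ 0) {w : Fin 4 → k}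
    (h : IsHyperbolicForm (QuadraticMap.weightedSumSquares k w)) : IsSquare (∏ i, w i) := by
  have : Invertible (2 : k) := invertibleOfNonzero h2
  obtain ⟨m, ⟨e⟩⟩ := h
  have hm : m = 2 := by
    have := e.toLinearEquiv.finrank_eq
    simp only [Module.finrank_fintype_fun_eq_card, Fintype.card_fin, Fintype.card_sum] at this
    omega
  subst hm
  obtain ⟨v, hv⟩ : ∃ v : Fin 4 → k, v = fun i => Sum.elim (fun _ : Fin 2 => (1 : k))
    (fun _ : Fin 2 => -1) (finSumFinEquiv.symm i) := ⟨_, rfl⟩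
  let f : (Fin 4 → k) →ₗ[k] Fin 4 → k :=
    (LinearMap.funLeft k k (finSumFinEquiv (m := 2) (n := 2)).symm).comp
      e.toLinearEquiv.toLinearMap
  have hf : (QuadraticMap.weightedSumSquares k v).comp f = QuadraticMap.weightedSumSquares k w := by
    ext x
    rw [← e.map_app x]
    simp only [QuadraticMap.comp_apply, QuadraticMap.weightedSumSquares_apply]
    rw [← Equiv.sum_comp (finSumFinEquiv (m := 2) (n := 2))]
    refine Finset.sum_congr rfl fun i _ => ?_
    simp [hv, f, LinearMap.funLeft_apply]
  rw [← discr'_weightedSumSquares_fin_four, ← hf, QuadraticForm.discr'_comp,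
    discr'_weightedSumSquares_fin_four]
  have hv' : ∏ i, v i = 1 := by
    rw [← Equiv.prod_comp (finSumFinEquiv (m := 2) (n := 2)), hv]
    simp
  rw [hv', mul_one]
  exact ⟨_, rfl⟩

theorem diagAnisotropic_one_neg_iff {c : k} : DiagAnisotropic ![1, -c] ↔ ¬ IsSquare c := by
  constructor
  · rintro h ⟨t, rfl⟩
    have := h ![t, 1] (by
      simp only [Fin.sum_univ_two, Matrix.cons_val_zero, Matrix.cons_val_one]
      ring) 1
    simp at this
  · intro h v hv
    simp only [Fin.sum_univ_two, Matrix.cons_val_zero, Matrix.cons_val_one] at hv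
    have h1 : v 1 = 0 := by
      by_contra h1
      apply h
      refine ⟨v 0 / v 1, ?_⟩
      field_simp
      linear_combination -hv
    intro i
    fin_cases i
    · rw [h1] at hv
      have h0 : v 0 ^ 2 = 0 := by linear_combination hv
      exact eq_zero_of_pow_eq_zero h0
    · exact h1

end Hyperbolic

/-! ### Subfields generated by generic points. -/

section Tower

variable {F K : Type u} [Field F] [Field K] [Algebra F K]

/-- A vector has finitely many coordinates, so a zero over the union of a chain already lies in one
member. -/
theorem DiagAnisotropic.iSup {ι J : Type*} [Fintype ι] [Nonempty J] [LinearOrder J] {b : ι → F}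
    {N : J → IntermediateField F K} (hN : Monotone N)
    (h : ∀ j, DiagAnisotropic fun i => algebraMap F (N j) (b i)) :
    DiagAnisotropic fun i => algebraMap F (⨆ j, N j : IntermediateField F K) (b i) := by
  intro v hv
  have hmem : ∀ i, ∃ j, (v i : K) ∈ N j := by
    intro i
    have := (v i).2
    rw [← SetLike.mem_coe, IntermediateField.coe_iSup_of_directed hN.directed_le,
      Set.mem_iUnion] at this
    exact this
  choose j hj using hmem
  obtain ⟨m, hm⟩ := Finite.exists_le j
  have h0 := h m (fun i => ⟨v i, hN (hm i) (hj i)⟩) (by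
    apply Subtype.ext
    have := congrArg (algebraMap (⨆ j, N j : IntermediateField F K) K) hv
    simpa using this)
  intro i
  have h1 : (v i : K) = 0 := congrArg Subtype.val (h0 i)
  exact Subtype.ext h1

/-- The subfield generated by the coordinates of the points `z i`, `i ∈ s`. -/
def pointsField {I : Type*} (F : Type u) {K : Type u} [Field F] [Field K] [Algebra F K]
    (z : I → Fin 4 → K) (s : Set I) : IntermediateField F K :=
  IntermediateField.adjoin F (⋃ i ∈ s, Set.range (z i))

variable {I : Type u} {z : I → Fin 4 → K}

theorem pointsField_mono : Monotone (pointsField F z) := fun _ _ h =>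
  IntermediateField.adjoin.mono _ _ _ (Set.biUnion_subset_biUnion_left h)

theorem mem_pointsField {s : Set I} {i : I} (hi : i ∈ s) (n : Fin 4) :
    z i n ∈ pointsField F z s :=
  IntermediateField.subset_adjoin _ _ (Set.mem_biUnion hi ⟨n, rfl⟩)

theorem pointsField_eq_iSup [Preorder I] {s : Set I} (hs : IsLowerSet s) :
    pointsField F z s = ⨆ j : s, pointsField F z (Set.Iic (j : I)) := by
  apply le_antisymm
  · rw [pointsField, IntermediateField.adjoin_le_iff]
    refine Set.iUnion₂_subset fun i hi => ?_
    rintro _ ⟨n, rfl⟩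
    exact le_iSup (fun j : s => pointsField F z (Set.Iic (j : I))) ⟨i, hi⟩
      (mem_pointsField (Set.mem_Iic.2 le_rfl) n)
  · exact iSup_le fun j => pointsField_mono fun i hi => hs hi j.2

/-- The field of the points in `s` is algebraic over the one generated by their last three
coordinates, since each `z j 0` is a square root of an element of the latter. Algebraic extensions
of the base preserve independence. -/
theorem algebraicIndependent_pointsField
    (hz : AlgebraicIndependent F fun p : I × Fin 3 => z p.1 p.2.succ)
    {w : I → Fin 4 → Fˣ} (hq : ∀ i, ∑ n, algebraMap F K (w i n : F) * z i n ^ 2 = 0)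
    {s : Set I} {i : I} (hi : i ∉ s) :
    AlgebraicIndependent (pointsField F z s) fun n : Fin 3 => z i n.succ := by
  obtain ⟨x, hx⟩ : ∃ x : I × Fin 3 → K, x = fun p => z p.1 p.2.succ := ⟨_, rfl⟩
  rw [← hx] at hz
  let T : Set (I × Fin 3) := {p | p.1 ∈ s}
  let A := IntermediateField.adjoin F (x '' T)
  have h1 : AlgebraicIndependent A fun n : Fin 3 => z i n.succ := by
    rw [IntermediateField.algebraicIndependent_adjoin_iff]
    have h2 := (hz.adjoin_of_disjoint (s := T) (t := Tᶜ) disjoint_compl_right).comp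
      (fun n : Fin 3 => ⟨(i, n), hi⟩) (fun m n h => by simpa using h)
    simpa [hx, Function.comp_def] using h2
  let B := IntermediateField.adjoin A {y | ∃ j ∈ s, y = z j 0}
  have hB : Algebra.IsAlgebraic A B := by
    refine IntermediateField.isAlgebraic_adjoin ?_
    rintro _ ⟨j, hj, rfl⟩
    have hmem : z j 0 ^ 2 ∈ A := by
      have h0 : algebraMap F K (w j 0 : F) ≠ 0 := (map_ne_zero _).2 (w j 0).ne_zero
      have h2 := hq j
      rw [Fin.sum_univ_succ] at h2
      have h3 : z j 0 ^ 2 = (algebraMap F K (w j 0 : F))⁻¹ *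
          -∑ n : Fin 3, algebraMap F K (w j n.succ : F) * z j n.succ ^ 2 := by
        rw [← eq_neg_of_add_eq_zero_left h2, inv_mul_cancel_left₀ h0]
      rw [h3]
      refine mul_mem (inv_mem (A.algebraMap_mem _)) (neg_mem (sum_mem fun n _ => ?_))
      refine mul_mem (A.algebraMap_mem _) (pow_mem ?_ 2)
      refine IntermediateField.subset_adjoin _ _ ⟨(j, n), hj, ?_⟩
      rw [hx]
    refine IsIntegral.of_pow (n := 2) two_pos ?_
    exact isIntegral_algebraMap (x := (⟨z j 0 ^ 2, hmem⟩ : A))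
  have h3 : AlgebraicIndependent B fun n : Fin 3 => z i n.succ := h1.extendScalars B
  have hle : pointsField F z s ≤ B.restrictScalars F := by
    rw [pointsField, IntermediateField.adjoin_le_iff]
    refine Set.iUnion₂_subset fun j hj => ?_
    rintro _ ⟨n, rfl⟩
    refine Fin.cases ?_ (fun n => ?_) n
    · exact IntermediateField.subset_adjoin A _ ⟨j, hj, rfl⟩
    · refine B.algebraMap_mem ⟨z j n.succ, ?_⟩
      exact IntermediateField.subset_adjoin _ _ ⟨(j, n), hj, by rw [hx]⟩
  let : Algebra (pointsField F z s) B := (IntermediateField.inclusion hle).toRingHom.toAlgebra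
  have : IsScalarTower (pointsField F z s) B K := IsScalarTower.of_algebraMap_eq fun _ => rfl
  exact h3.restrictScalars (IntermediateField.inclusion hle).injective

end Tower

/-! ### Transfinite induction for anisotropy along the tower. -/

section TowerAnisotropy

variable {F K : Type u} [Field F] [Field K] [Algebra F K] {I : Type u} {z : I → Fin 4 → K}

theorem IntermediateField.mem_adjoin_of_mem_base {M : IntermediateField F K} {x : K} (hx : x ∈ M)
    (S : Set K) : x ∈ IntermediateField.adjoin M S :=
  (IntermediateField.adjoin M S).algebraMap_mem ⟨x, hx⟩

theorem extendScalars_pointsField [LinearOrder I] (i : I)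
    (h : pointsField F z (Set.Iio i) ≤ pointsField F z (Set.Iic i)) :
    IntermediateField.extendScalars h =
      IntermediateField.adjoin (pointsField F z (Set.Iio i)) (Set.range (z i)) := by
  apply le_antisymm
  · intro x hx
    have hle : pointsField F z (Set.Iic i) ≤ (IntermediateField.adjoin
        (pointsField F z (Set.Iio i)) (Set.range (z i))).restrictScalars F := by
      rw [pointsField, IntermediateField.adjoin_le_iff]
      refine Set.iUnion₂_subset fun j hj => ?_
      rintro _ ⟨n, rfl⟩
      rw [SetLike.mem_coe, IntermediateField.mem_restrictScalars]
      rcases (Set.mem_Iic.1 hj).lt_or_eq with hlt | hji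
      · exact IntermediateField.mem_adjoin_of_mem_base
          (mem_pointsField (F := F) (z := z) (s := Set.Iio i) hlt n) _
      · rw [hji]
        exact IntermediateField.subset_adjoin _ _ (Set.mem_range_self n)
    exact hle hx
  · rw [IntermediateField.adjoin_le_iff]
    rintro _ ⟨n, rfl⟩
    rw [SetLike.mem_coe, IntermediateField.mem_extendScalars]
    exact mem_pointsField (Set.mem_Iic.2 le_rfl) n

theorem DiagAnisotropic.pointsField_of_isLowerSet {ι : Type*} [Fintype ι] {b : ι → F}
    [LinearOrder I] {s : Set I} (hs : IsLowerSet s) (hb : DiagAnisotropic b)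
    (h : ∀ j ∈ s, DiagAnisotropic fun n => algebraMap F (pointsField F z (Set.Iic j)) (b n)) :
    DiagAnisotropic fun n => algebraMap F (pointsField F z s) (b n) := by
  rcases s.eq_empty_or_nonempty with rfl | hne
  · have h0 : pointsField F z ∅ = ⊥ := by simp [pointsField]
    rw [h0]
    refine DiagAnisotropic.of_injective (IntermediateField.botEquiv F K : _ →+* F)
      (IntermediateField.botEquiv F K).injective ?_
    simpa using hb
  · have := hne.to_subtype
    rw [pointsField_eq_iSup hs]
    exact DiagAnisotropic.iSup (fun _ _ hij => pointsField_mono (Set.Iic_subset_Iic.2 hij))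
      fun j => h j j.2

/-- The field at `Iio i` is the union of the earlier stages, so anisotropy passes to it by
induction; `hstep` handles the adjunction of the point `z i`. Limit and successor stages need no
separate treatment. -/
theorem DiagAnisotropic.pointsField [LinearOrder I] [WellFoundedLT I] {ι : Type*} [Fintype ι]
    {b : ι → F} (hb : DiagAnisotropic b)
    (hstep : ∀ i, (DiagAnisotropic fun n => algebraMap F (pointsField F z (Set.Iio i)) (b n)) →
      DiagAnisotropic fun n => algebraMap (pointsField F z (Set.Iio i))
        (IntermediateField.adjoin (pointsField F z (Set.Iio i)) (Set.range (z i)))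
        (algebraMap F (pointsField F z (Set.Iio i)) (b n)))
    {s : Set I} (hs : IsLowerSet s) :
    DiagAnisotropic fun n => algebraMap F (pointsField F z s) (b n) := by
  refine pointsField_of_isLowerSet hs hb fun j hj => ?_
  induction j using WellFoundedLT.induction with
  | _ i ih =>
  have hle := pointsField_mono (F := F) (z := z) (Set.Iio_subset_Iic_self (a := i))
  have h1 := hstep i (pointsField_of_isLowerSet (isLowerSet_Iio i) hb fun j hji => ih j hji
    (hs (le_of_lt hji) hj))
  rw [← extendScalars_pointsField i hle] at h1
  exact h1

end TowerAnisotropy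

/-! ### Construction of the tower. -/

section TowerExistence

theorem map_comp_binary {R S : Type*} [CommRing R] [CommRing S] (f : R →+* S) (c : R) :
    (fun i => f (![1, -c] i)) = ![1, -f c] := by
  funext i
  fin_cases i <;> simp

theorem map_comp_quaternionNorm {R S : Type*} [CommRing R] [CommRing S] (f : R →+* S) (a b : R) :
    (fun i => f (![1, -a, -b, a * b] i)) = ![1, -f a, -f b, f a * f b] := by
  funext i
  fin_cases i <;> simp

variable {F K : Type u} [Field F] [Field K] [Algebra F K] {I : Type u} {z : I → Fin 4 → K}

theorem two_ne_zero_of_algebra (h2 : (2 : F) ≠ 0) (L : Type*) [Field L] [Algebra F L] :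
    (2 : L) ≠ 0 := by
  rw [← map_ofNat (algebraMap F L) 2]
  exact (map_ne_zero _).2 h2

variable {w : I → Fin 4 → Fˣ}

theorem quadric_relation_base (hq : ∀ i, ∑ n, algebraMap F K (w i n : F) * z i n ^ 2 = 0) (i : I)
    (s : Set I) :
    ∑ n, algebraMap (pointsField F z s) K (algebraMap F (pointsField F z s) (w i n : F)) *
      z i n ^ 2 = 0 := by
  rw [← hq i]
  rfl

/-- Generic points on a family of quadrics. -/
theorem exists_generic_points (F : Type u) [Field F] {I : Type u} (w : I → Fin 4 → Fˣ) :
    ∃ (K : Type u) (_ : Field K) (_ : Algebra F K) (z : I → Fin 4 → K),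
      (AlgebraicIndependent F fun p : I × Fin 3 => z p.1 p.2.succ) ∧
      (∀ i, ∑ n, algebraMap F K (w i n : F) * z i n ^ 2 = 0) ∧
      pointsField F z Set.univ = ⊤ := by
  -- All points are constructed at once: three independent variables for each quadric, and the
  -- remaining coordinate as a square root in an algebraic closure.
  let R := MvPolynomial (I × Fin 3) F
  let Ω := AlgebraicClosure (FractionRing R)
  have hinj : Function.Injective (algebraMap R Ω) := by
    rw [IsScalarTower.algebraMap_eq R (FractionRing R) Ω]
    exact (algebraMap (FractionRing R) Ω).injective.comp (IsFractionRing.injective R _)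
  obtain ⟨x, hx⟩ : ∃ x : I × Fin 3 → Ω, AlgebraicIndependent F x :=
    ⟨_, (MvPolynomial.algebraicIndependent_X (I × Fin 3) F).map' (f := IsScalarTower.toAlgHom F R Ω)
      hinj⟩
  have hy : ∀ i, ∃ y : Ω, y ^ 2 = -(∑ n : Fin 3, algebraMap F Ω (w i n.succ : F) * x (i, n) ^ 2) /
      algebraMap F Ω (w i 0 : F) := fun i => IsAlgClosed.exists_pow_nat_eq _ two_pos
  choose y hy using hy
  let Z : I → Fin 4 → Ω := fun i => Fin.cons (y i) fun n => x (i, n)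
  let N := pointsField F Z Set.univ
  let z : I → Fin 4 → N := fun i n => ⟨Z i n, mem_pointsField (Set.mem_univ i) n⟩
  refine ⟨N, inferInstance, inferInstance, z, ?_, fun i => ?_, ?_⟩
  · exact AlgebraicIndependent.of_comp N.val hx
  · apply Subtype.ext
    have h0 : algebraMap F Ω (w i 0 : F) ≠ 0 := (map_ne_zero _).2 (w i 0).ne_zero
    have h1 : ∑ n, algebraMap F Ω (w i n : F) * Z i n ^ 2 = 0 := by
      rw [Fin.sum_univ_succ]
      simp only [Z, Fin.cons_zero, Fin.cons_succ, hy]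
      rw [mul_div_cancel₀ _ h0, neg_add_cancel]
    rw [← map_zero (algebraMap F Ω)] at h1
    simpa [z] using h1
  · apply IntermediateField.map_injective N.val
    rw [pointsField, IntermediateField.adjoin_map, ← AlgHom.fieldRange_eq_map,
      IntermediateField.fieldRange_val]
    refine congrArg _ ?_
    simp only [Set.image_iUnion, ← Set.range_comp]
    rfl

variable [LinearOrder I]

/-- Applied to the discriminants of the quadrics, this keeps each of them nontrivial over the field
at which its quadric enters the tower. -/
theorem not_isSquare_prod [WellFoundedLT I] (h2 : (2 : F) ≠ 0)
    (hz : AlgebraicIndependent F fun p : I × Fin 3 => z p.1 p.2.succ)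
    (hq : ∀ i, ∑ n, algebraMap F K (w i n : F) * z i n ^ 2 = 0)
    {c : F} (hc : ¬ IsSquare c) {s : Set I} (hs : IsLowerSet s) :
    ¬ IsSquare (algebraMap F (pointsField F z s) c) := by
  rw [← diagAnisotropic_one_neg_iff, ← map_comp_binary]
  refine (diagAnisotropic_one_neg_iff.2 hc).pointsField (fun i hi => ?_) hs
  rw [map_comp_binary] at hi
  have h := hi.adjoin_binary (two_ne_zero_of_algebra h2 _)
    (w := fun n => algebraMap F (pointsField F z (Set.Iio i)) (w i n : F))
    (fun n => (map_ne_zero _).2 (w i n).ne_zero)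
    (algebraicIndependent_pointsField hz hq (Set.self_notMem_Iio))
    (quadric_relation_base hq i _)
  rw [← map_comp_binary] at h
  exact h

theorem diagAnisotropic_quaternionNorm_pointsField [WellFoundedLT I] (h2 : (2 : F) ≠ 0)
    (hz : AlgebraicIndependent F fun p : I × Fin 3 => z p.1 p.2.succ)
    (hq : ∀ i, ∑ n, algebraMap F K (w i n : F) * z i n ^ 2 = 0)
    (hdisc : ∀ i, ¬ IsSquare (∏ n, (w i n : F))) {a b : F}
    (hab : DiagAnisotropic ![1, -a, -b, a * b]) {s : Set I} (hs : IsLowerSet s) :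
    DiagAnisotropic fun n => algebraMap F (pointsField F z s) (![1, -a, -b, a * b] n) := by
  refine hab.pointsField (fun i hi => ?_) hs
  rw [map_comp_quaternionNorm] at hi
  have h := hi.adjoin_quaternionNorm (two_ne_zero_of_algebra h2 _)
    (w := fun n => algebraMap F (pointsField F z (Set.Iio i)) (w i n : F))
    (fun n => (map_ne_zero _).2 (w i n).ne_zero)
    (by
      rw [← map_prod]
      exact not_isSquare_prod h2 hz hq (hdisc i) (isLowerSet_Iio i))
    (algebraicIndependent_pointsField hz hq (Set.self_notMem_Iio))
    (quadric_relation_base hq i _)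
  rw [← map_comp_quaternionNorm] at h
  exact h

theorem isQuadricTower_of_points [WellFoundedLT I] (h2 : (2 : F) ≠ 0)
    (hz : AlgebraicIndependent F fun p : I × Fin 3 => z p.1 p.2.succ)
    (hq : ∀ i, ∑ n, algebraMap F K (w i n : F) * z i n ^ 2 = 0)
    (hdisc : ∀ i, ¬ IsSquare (∏ n, (w i n : F))) (htop : pointsField F z Set.univ = ⊤) :
    IsQuadricTower F K := by
  refine ⟨I, inferInstance, inferInstance, fun i => pointsField F z (Set.Iic i), w, ?_,
    fun i => ⟨pointsField F z (Set.Iio i), pointsField_mono Set.Iio_subset_Iic_self,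
      pointsField_eq_iSup (isLowerSet_Iio i), fun h => ?_, ?_⟩⟩
  · rw [← htop, pointsField_eq_iSup isLowerSet_univ]
    exact (Equiv.Set.univ I).symm.iSup_congr fun _ => rfl
  · have h3 := isSquare_prod_of_isHyperbolicForm (two_ne_zero_of_algebra h2 _) h
    rw [← map_prod] at h3
    exact not_isSquare_prod h2 hz hq (hdisc i) (isLowerSet_Iio i) h3
  · rw [extendScalars_pointsField]
    exact nonempty_bigFunctionField_algEquiv (two_ne_zero_of_algebra h2 _)
      (fun n => (map_ne_zero _).2 (w i n).ne_zero)
      (algebraicIndependent_pointsField hz hq (Set.self_notMem_Iio))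
      (quadric_relation_base hq i _)

/-- There is a quadric tower over `F` which preserves division of quaternion algebras and over which
every quaternion division algebra defined over `F` contains square roots of all elements of `F`. -/
theorem exists_quadricTower (F : Type u) [Field F] (h2 : (2 : F) ≠ 0) :
    ∃ (K : Type u) (_ : Field K) (_ : Algebra F K), IsQuadricTower F K ∧
      (∀ a b : F, DiagAnisotropic ![1, -a, -b, a * b] →
        DiagAnisotropic ![1, -algebraMap F K a, -algebraMap F K b,
          algebraMap F K a * algebraMap F K b]) ∧
      ∀ a b c : F, DiagAnisotropic ![1, -a, -b, a * b] → ¬ IsSquare c →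
        ∃ x y t : K, algebraMap F K a * x ^ 2 + algebraMap F K b * y ^ 2
          - algebraMap F K a * algebraMap F K b * t ^ 2 = algebraMap F K c := by
  let I := {t : Fˣ × Fˣ × Fˣ // ¬ IsSquare (t.2.2 : F)}
  let w : I → Fin 4 → Fˣ := fun t => ![-t.1.2.2, t.1.1, t.1.2.1, -(t.1.1 * t.1.2.1)]
  -- Any well-order works, since the preservation results hold for the quadrics in every order.
  obtain ⟨_, _⟩ := exists_wellFoundedLT I
  obtain ⟨K, _, _, z, hz, hq, htop⟩ := exists_generic_points F w
  have hdisc : ∀ i, ¬ IsSquare (∏ n, (w i n : F)) := by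
    rintro ⟨⟨a, b, c⟩, hc⟩ ⟨r, hr⟩
    apply hc
    refine ⟨r / (a * b), ?_⟩
    rw [Fin.prod_univ_four] at hr
    simp [w] at hr
    field_simp
    linear_combination hr
  have haniso : ∀ a b : F, DiagAnisotropic ![1, -a, -b, a * b] →
      DiagAnisotropic ![1, -algebraMap F K a, -algebraMap F K b,
        algebraMap F K a * algebraMap F K b] := by
    intro a b hab
    have h := diagAnisotropic_quaternionNorm_pointsField h2 hz hq hdisc hab isLowerSet_univ
    rw [htop] at h
    rw [← map_comp_quaternionNorm]
    refine DiagAnisotropic.of_injective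
      (IntermediateField.topEquiv (F := F) (E := K)).symm.toRingEquiv.toRingHom
      (IntermediateField.topEquiv (F := F) (E := K)).symm.injective ?_
    convert h using 1
    funext n
    exact (IntermediateField.topEquiv (F := F) (E := K)).symm.commutes _
  refine ⟨K, inferInstance, inferInstance, isQuadricTower_of_points h2 hz hq hdisc htop, haniso,
    fun a b c hab hc => ?_⟩
  have ha : a ≠ 0 := neg_ne_zero.1 (by simpa using hab.ne_zero 1)
  have hb : b ≠ 0 := neg_ne_zero.1 (by simpa using hab.ne_zero 2)
  have hc0 : c ≠ 0 := by
    rintro rfl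
    exact hc ⟨0, by simp⟩
  let i : I := ⟨(Units.mk0 a ha, Units.mk0 b hb, Units.mk0 c hc0), hc⟩
  have hi := hq i
  simp [w, i, Fin.sum_univ_four] at hi
  have hx : z i 1 ≠ 0 := hz.ne_zero (i, (0 : Fin 3))
  -- If `z i 0` vanished, the other coordinates would give a nontrivial zero of the norm form of
  -- `(a, b)` over `K`.
  have hy : z i 0 ≠ 0 := by
    intro h0
    apply hx
    refine haniso a b hab ![0, z i 1, z i 2, z i 3] ?_ 1
    simp only [Fin.sum_univ_four, Matrix.cons_val_zero, Matrix.cons_val_one, Matrix.cons_val]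
    rw [h0] at hi
    linear_combination -hi
  refine ⟨z i 1 / z i 0, z i 2 / z i 0, z i 3 / z i 0, ?_⟩
  field_simp
  linear_combination hi

end TowerExistence

/-! ### Square roots and maximal subfields inside quaternion algebras. -/

section QuaternionClasses

/-- The splitting field maps into `k` or into `k[X]/(X² - c)`, according to whether `c` is a square.
From there, scalars or evaluation at `q` lead to the possibly noncommutative `A`. -/
theorem nonempty_algHom_sqrtField {k : Type u} [Field k] {A : Type*} [Ring A] [Algebra k A] {c : k}
    {q : A} (hq : q * q = algebraMap k A c) : Nonempty (SqrtField k c →ₐ[k] A) := by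
  open Polynomial in
  have hsplit : ∀ {L : Type u} [Field L] [Algebra k L] (t : L), t * t = algebraMap k L c →
      ((X ^ 2 - C c : k[X]).map (algebraMap k L)).Splits := by
    intro L _ _ t ht
    have : (X ^ 2 - C c : k[X]).map (algebraMap k L) = (X - C t) * (X + C t) := by
      simp only [Polynomial.map_sub, Polynomial.map_pow, map_X, map_C, ← ht, C_mul]
      ring
    rw [this]
    exact (Splits.X_sub_C t).mul (Splits.X_add_C t)
  by_cases hc : IsSquare c
  · obtain ⟨t, ht⟩ := hc
    exact ⟨(Algebra.ofId k A).comp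
      (Polynomial.SplittingField.lift _ (hsplit (L := k) t (by rw [ht]; rfl)))⟩
  · have hirr : Irreducible (Polynomial.X ^ 2 - Polynomial.C c : Polynomial k) :=
      X_pow_sub_C_irreducible_of_prime Nat.prime_two fun b hb => hc ⟨b, by rw [← hb, sq]⟩
    have : Fact (Irreducible (Polynomial.X ^ 2 - Polynomial.C c : Polynomial k)) := ⟨hirr⟩
    let L := AdjoinRoot (Polynomial.X ^ 2 - Polynomial.C c : Polynomial k)
    have hroot : AdjoinRoot.root (Polynomial.X ^ 2 - Polynomial.C c) *
        AdjoinRoot.root (Polynomial.X ^ 2 - Polynomial.C c) = algebraMap k L c := by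
      have := AdjoinRoot.eval₂_root (Polynomial.X ^ 2 - Polynomial.C c : Polynomial k)
      simp only [Polynomial.eval₂_sub, Polynomial.eval₂_pow, Polynomial.eval₂_X,
        Polynomial.eval₂_C] at this
      rw [← sq, sub_eq_zero.1 this]
      rfl
    let f : L →ₐ[k] A := Ideal.Quotient.liftₐ _ (Polynomial.aeval q) (by
      intro p hp
      obtain ⟨r, rfl⟩ := Ideal.mem_span_singleton.1 hp
      rw [map_mul, map_sub, map_pow, Polynomial.aeval_X, Polynomial.aeval_C, sq, hq, sub_self,
        zero_mul])
    exact ⟨f.comp (Polynomial.SplittingField.lift _ (hsplit (L := L) _ hroot))⟩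

theorem isUnit_of_algEquiv {k A B : Type*} [Field k] [Ring A] [Ring B] [Algebra k A] [Algebra k B]
    (e : A ≃ₐ[k] B) (h : ∀ x : A, x ≠ 0 → IsUnit x) (y : B) (hy : y ≠ 0) : IsUnit y := by
  have h1 := (h (e.symm y) (by rwa [ne_eq, EmbeddingLike.map_eq_zero_iff])).map e
  rwa [AlgEquiv.apply_symm_apply] at h1

theorem nonempty_baseChange_algEquiv {F A : Type*} (K : Type*) [Field F] [Field K] [Algebra F K]
    [Ring A] [Algebra F A] {a b : F} (e : A ≃ₐ[F] ℍ[F, a, b]) :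
    Nonempty (K ⊗[F] A ≃ₐ[K] ℍ[K, algebraMap F K a, algebraMap F K b]) :=
  ⟨(Algebra.TensorProduct.congr AlgEquiv.refl e).trans
    (AlgEquiv.ofBijective _ (quaternionBaseChangeHom_bijective F K a b)).symm⟩

/-- A maximal subfield of a quaternion division algebra contains a square root of a scalar which
is not a scalar itself. -/
theorem IsMaximalSubfield.exists_sq {k A : Type*} [Field k] [Ring A] [Algebra k A] {a b : k}
    (e : A ≃ₐ[k] ℍ[k, a, b]) (h : DiagAnisotropic ![1, -a, -b, a * b]) {E : Subalgebra k A}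
    (hE : IsMaximalSubfield E) :
    ∃ x ∈ E, ∃ c : k, x * x = algebraMap k A c ∧ ∀ r : k, x ≠ algebraMap k A r := by
  obtain ⟨y, hyE, hy⟩ : ∃ y ∈ E, ∀ r : k, y ≠ algebraMap k A r := by
    by_contra! hcon
    -- `D` is `k(i)`. If `E` consisted of scalars, the preimage of `D` would be a strictly larger
    -- field, against maximality.
    let D : Subalgebra k ℍ[k, a, b] :=
      { carrier := {q | q.imJ = 0 ∧ q.imK = 0}
        mul_mem' := by
          rintro p q ⟨hp, hp'⟩ ⟨hq, hq'⟩
          constructor <;> simp [hp, hp', hq, hq']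
        add_mem' := by
          rintro p q ⟨hp, hp'⟩ ⟨hq, hq'⟩
          constructor <;> simp [hp, hp', hq, hq']
        algebraMap_mem' := fun r => ⟨rfl, rfl⟩ }
    have hD : IsField (D.comap (e : A →ₐ[k] ℍ[k, a, b])) := by
      refine ⟨⟨0, 1, ?_⟩, ?_, ?_⟩
      · intro h0
        have h1 : e 0 = e 1 := congrArg (fun t => e t.1) h0
        rw [map_zero, map_one] at h1
        simpa using congrArg (fun q => q.re) h1
      · rintro ⟨p, hp⟩ ⟨q, hq⟩
        apply Subtype.ext
        apply e.injective
        change e (p * q) = e (q * p)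
        rw [map_mul, map_mul]
        obtain ⟨hp1, hp2⟩ : (e p).imJ = 0 ∧ (e p).imK = 0 := hp
        obtain ⟨hq1, hq2⟩ : (e q).imJ = 0 ∧ (e q).imK = 0 := hq
        ext <;> simp [hp1, hp2, hq1, hq2] <;> ring
      · rintro ⟨p, hp⟩ hp0
        have hN : reducedNorm (e p) ≠ 0 := by
          intro h0
          apply hp0
          apply Subtype.ext
          apply e.injective
          rw [eq_zero_of_reducedNorm_eq_zero h h0]
          exact (map_zero e).symm
        obtain ⟨hp1, hp2⟩ : (e p).imJ = 0 ∧ (e p).imK = 0 := hp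
        refine ⟨⟨e.symm ((reducedNorm (e p))⁻¹ • star (e p)), ?_⟩, ?_⟩
        · change (e (e.symm _)).imJ = 0 ∧ (e (e.symm _)).imK = 0
          rw [AlgEquiv.apply_symm_apply]
          constructor <;> simp [hp1, hp2]
        · apply Subtype.ext
          apply e.injective
          change e (p * e.symm _) = e 1
          rw [map_mul, AlgEquiv.apply_symm_apply, mul_smul_comm, mul_star_eq_reducedNorm,
            Algebra.smul_def, ← map_mul, inv_mul_cancel₀ hN, map_one, map_one]
    have hle : E ≤ D.comap (e : A →ₐ[k] ℍ[k, a, b]) := by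
      intro y hy
      obtain ⟨r, rfl⟩ := hcon y hy
      exact Subalgebra.algebraMap_mem _ r
    obtain ⟨r, hr⟩ := hcon (e.symm ⟨0, 1, 0, 0⟩) (hE.2 hD hle (by
      change (e (e.symm _)).imJ = 0 ∧ (e (e.symm _)).imK = 0
      rw [AlgEquiv.apply_symm_apply]
      exact ⟨rfl, rfl⟩))
    have := congrArg e hr
    rw [AlgEquiv.apply_symm_apply, AlgEquiv.commutes] at this
    simpa using congrArg (fun q => q.imI) this
  -- Removing the scalar part of `y` leaves a pure quaternion, whose square is minus its norm.
  obtain ⟨p, hp⟩ : ∃ p, p = e y - algebraMap k _ (e y).re := ⟨_, rfl⟩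
  have hx : e (y - algebraMap k A (e y).re) = p := by
    rw [hp, map_sub, AlgEquiv.commutes]
  refine ⟨y - algebraMap k A (e y).re, sub_mem hyE (E.algebraMap_mem _), -reducedNorm p, ?_, ?_⟩
  · apply e.injective
    rw [map_mul, hx, AlgEquiv.commutes]
    have hpre : p.re = 0 := by rw [hp]; simp
    rw [QuaternionAlgebra.algebraMap_eq]
    ext <;> simp [hpre, reducedNorm] <;> ring
  · intro r hr
    exact hy (r + (e y).re) (by rw [map_add, ← hr, sub_add_cancel])

theorem exists_quaternionAlgebra_algEquiv_of_isQuaternionAlgebra {k A : Type*} [Field k] [Ring A]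
    [Algebra k A] (hA : IsQuaternionAlgebra k A) (h : ∀ x : A, x ≠ 0 → IsUnit x) :
    ∃ a b : k, DiagAnisotropic ![1, -a, -b, a * b] ∧ Nonempty (A ≃ₐ[k] ℍ[k, a, b]) := by
  obtain ⟨a, b, ⟨e⟩⟩ := hA
  exact ⟨a, b, diagAnisotropic_of_isUnit (isUnit_of_algEquiv e h), ⟨e⟩⟩

theorem QuatDiv.isUnit {k : Type u} [Field k] {A : QuatAlg k}
    (h : (Quotient.mk _ A : Quat k) ∈ QuatDiv k) (x : A.carrier) (hx : x ≠ 0) : IsUnit x := by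
  obtain ⟨B, hB, hu⟩ := h
  obtain ⟨e⟩ := Quotient.exact hB
  exact isUnit_of_algEquiv e.symm hu x hx

end QuaternionClasses

/-! ### The main theorem. -/

theorem proposition3p1 (F : Type u) [Field F] (hF : ringChar F ≠ 2)
    (𝒟 : Set (Quat F)) (h𝒟 : 𝒟 ⊆ QuatDiv F) (hlinked : 𝒟.Pairwise Quat.Linked)
    (S : Set (SquareClass F)) :
    ∃ (K : Type u) (_ : Field K) (_ : Algebra F K),
      IsQuadricTower F K ∧
      Set.MapsTo (Quat.extend K) 𝒟 (QuatDiv K) ∧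
      Set.InjOn (Quat.extend K) 𝒟 ∧
      ∀ D ∈ 𝒟, ∀ c : Fˣ, (QuotientGroup.mk c : SquareClass F) ∈ S →
        (Quat.extend K D).Contains (SqrtField K (algebraMap F K (c : F))) := by
  have h2 : (2 : F) ≠ 0 := Ring.two_ne_zero hF
  obtain ⟨K, _, _, htower, haniso, hsqrt⟩ := exists_quadricTower F h2
  have h2K : (2 : K) ≠ 0 := two_ne_zero_of_algebra h2 K
  refine ⟨K, inferInstance, inferInstance, htower, ?_, ?_, ?_⟩
  · intro D hD
    obtain ⟨A, rfl, hA⟩ := h𝒟 hD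
    obtain ⟨a, b, hab, ⟨e⟩⟩ :=
      exists_quaternionAlgebra_algEquiv_of_isQuaternionAlgebra A.isQuaternion hA
    obtain ⟨e'⟩ := nonempty_baseChange_algEquiv K e
    exact ⟨A.baseChange K, rfl, isUnit_of_algEquiv e'.symm
      (isUnit_of_diagAnisotropic (haniso a b hab))⟩
  · intro D₁ hD₁ D₂ hD₂ heq
    by_contra hne
    obtain ⟨A, B, rfl, rfl, E, E', hE, hE', ⟨φ⟩⟩ := hlinked hD₁ hD₂ hne
    obtain ⟨a, b, hab, ⟨eA⟩⟩ := exists_quaternionAlgebra_algEquiv_of_isQuaternionAlgebra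
      A.isQuaternion (QuatDiv.isUnit (h𝒟 hD₁))
    obtain ⟨a', b', hab', ⟨eB⟩⟩ := exists_quaternionAlgebra_algEquiv_of_isQuaternionAlgebra
      B.isQuaternion (QuatDiv.isUnit (h𝒟 hD₂))
    -- The element `x` and its image under `φ` both have square `c`, so the two algebras become `(c,
    -- d₁)` and `(c, d₂)`.
    obtain ⟨x, hxE, c, hxx, hx⟩ := hE.exists_sq eA hab
    have hyy : ((φ ⟨x, hxE⟩ : E') : B.carrier) * (φ ⟨x, hxE⟩ : E') = algebraMap F _ c := by
      have h3 : (⟨x, hxE⟩ : E) * ⟨x, hxE⟩ = algebraMap F E c := Subtype.ext hxx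
      have h4 := congrArg φ h3
      rw [map_mul, AlgEquiv.commutes] at h4
      exact congrArg Subtype.val h4
    have hy : ∀ r : F, ((φ ⟨x, hxE⟩ : E') : B.carrier) ≠ algebraMap F _ r := by
      intro r hr
      have h3 : φ ⟨x, hxE⟩ = φ (algebraMap F E r) := by
        rw [AlgEquiv.commutes]
        exact Subtype.ext hr
      exact hx r (congrArg Subtype.val (φ.injective h3))
    obtain ⟨hc, d₁, hd₁, ⟨e₁⟩⟩ := exists_quaternionAlgebra_algEquiv_of_sq h2 hab (q := eA x)
      (by rw [← map_mul, hxx, AlgEquiv.commutes])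
      (fun r hr => hx r (eA.injective (by rw [hr, AlgEquiv.commutes])))
    obtain ⟨-, d₂, hd₂, ⟨e₂⟩⟩ := exists_quaternionAlgebra_algEquiv_of_sq h2 hab'
      (q := eB (φ ⟨x, hxE⟩ : E')) (by rw [← map_mul, hyy, AlgEquiv.commutes])
      (fun r hr => hy r (eB.injective (by rw [hr, AlgEquiv.commutes])))
    have an₁ := diagAnisotropic_of_isUnit
      (isUnit_of_algEquiv e₁.symm (isUnit_of_diagAnisotropic hab))
    have an₂ := diagAnisotropic_of_isUnit
      (isUnit_of_algEquiv e₂.symm (isUnit_of_diagAnisotropic hab'))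
    have an : DiagAnisotropic ![1, -c, -(d₁ * d₂), c * (d₁ * d₂)] := by
      by_contra hcon
      obtain ⟨e⟩ := nonempty_algEquiv_of_not_diagAnisotropic h2 an₁ hcon hd₂
      exact hne (Quotient.sound ⟨eA.trans (e₁.symm.trans (e.symm.trans (e₂.trans eB.symm)))⟩)
    have anK := haniso _ _ an
    rw [map_mul] at anK
    obtain ⟨g⟩ : Nonempty (K ⊗[F] A.carrier ≃ₐ[K] K ⊗[F] B.carrier) := Quotient.exact heq
    obtain ⟨g₁⟩ := nonempty_baseChange_algEquiv K (eA.trans e₁.symm)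
    obtain ⟨g₂⟩ := nonempty_baseChange_algEquiv K (eB.trans e₂.symm)
    exact (isEmpty_algEquiv_of_diagAnisotropic h2K (haniso _ _ an₂) anK).false
      (g₁.symm.trans (g.trans g₂))
  · intro D hD c _
    obtain ⟨A, rfl, hA⟩ := h𝒟 hD
    obtain ⟨a, b, hab, ⟨e⟩⟩ :=
      exists_quaternionAlgebra_algEquiv_of_isQuaternionAlgebra A.isQuaternion hA
    obtain ⟨e'⟩ := nonempty_baseChange_algEquiv K e
    refine ⟨A.baseChange K, rfl, ?_⟩
    obtain ⟨q, hq⟩ : ∃ q : ℍ[K, algebraMap F K a, algebraMap F K b],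
        q * q = algebraMap K _ (algebraMap F K c) := by
      by_cases hc : IsSquare (c : F)
      · obtain ⟨t, ht⟩ := hc
        exact ⟨algebraMap K _ (algebraMap F K t), by rw [ht, map_mul, map_mul]⟩
      · obtain ⟨x, y, t, hxyt⟩ := hsqrt a b c hab hc
        -- The square of this pure quaternion is the value of `⟨a, b, -ab⟩` at `(x, y, t)`, namely
        -- `c`.
        refine ⟨⟨0, x, y, t⟩, ?_⟩
        rw [QuaternionAlgebra.algebraMap_eq, ← hxyt]
        ext <;> simp <;> ring
    obtain ⟨f⟩ := nonempty_algHom_sqrtField hq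
    exact ⟨(e'.symm : _ →ₐ[K] K ⊗[F] A.carrier).comp f⟩
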